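/- For integers $k\ge 1$ and $n\ge 1$ let $d_k(n)$ be the number of ordered $k$-tuples of positive integers with product $n$ (the Piltz divisor function). For $z>0$ put $$G_k(z):=G^{k+1,0}_{0,2k}\Big(\begin{matrix}\text{---}\\(0)_k,\tfrac12:(\tfrac12)_{k-1}\end{matrix}\,\Big|\,z\Big)=\frac1{2\pi i}\int_{C-i\infty}^{C+i\infty}\frac{\Gamma(-s)^k\,\Gamma(\tfrac12-s)}{\Gamma(\tfrac12+s)^{k-1}}\,z^s\,ds\qquad(C<0),$$ a Meijer $G$-function whose first $k$ lower parameters are $0$ and whose remaining $k$ lower parameters are $\tfrac12$, and for $\rho,x>0$ put $$\Psi_{\rho,k}(x):=\frac{\pi^{k/2-1}}{2^{k-1}}\sum_{j=1}^\infty d_k(j)\,G_k\Big(\frac{\rho^2j^2x^2}{2^{2k}}\Big).$$ **Corollary (transformation of generalized Eisenstein series).** Let $k\ge 1$ and $m>1$ be integers, and let $\alpha,\beta>0$ be real with $\alpha\beta=\pi^2$. Then, for every choice of the abscissa $C<0$, the integrals and series above converge absolutely, and so do the two series over $n$ below; the function of $s$ in braces is holomorphic near $s=0$; and $$(\alpha^k)^m\sum_{n=1}^\infty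 d_k(n)\,n^{2m-1}\,\Psi_{(2\alpha)^k,k}(n)-(-\beta^k)^m\sum_{n=1}^\infty d_k(n)\,n^{2m-1}\,\Psi_{(2\beta)^k,k}(n)$$ $$=\frac1{(k-1)!}\,\frac{d^{k-1}}{ds^{k-1}}\Big\{\zeta^k(1-2m+s)\,\zeta^k(s)\,\Gamma^k(s+1)\,\cos^{k-1}\!\Big(\frac{\pi s}2\Big)\,2^{-ks}\Big(\alpha^{-k(s-m)}-(-1)^m\beta^{-k(s-m)}\Big)\Big\}\Big|_{s=0}.$$ -/

import Mathlib

/-- The Piltz divisor function `d_k(n)`: the number of `k`-tuples of positive integers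
`(n₁, …, n_k)` with `n₁ ⋯ n_k = n` (for `n ≥ 1`). -/
def piltzDivisor (k n : ℕ) : ℕ :=
  (Nat.finMulAntidiag k n).card

/-- The integrand in the Mellin–Barnes definition of the Meijer `G`-function
`G^{m,n}_{p,q}(a₁, …, a_p; b₁, …, b_q | z)`; the parameters are indexed from `0`. -/
noncomputable def meijerGIntegrand {p q : ℕ} (m n : ℕ) (a : Fin p → ℂ) (b : Fin q → ℂ)
    (z s : ℂ) : ℂ :=
  ((∏ j : Fin q with j.val < m, Complex.Gamma (b j - s)) *
      (∏ j : Fin p with j.val < n, Complex.Gamma (1 - a j + s))) /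
    ((∏ j : Fin q with m ≤ j.val, Complex.Gamma (1 - b j + s)) *
      (∏ j : Fin p with n ≤ j.val, Complex.Gamma (a j - s))) * z ^ s

/-- The Meijer `G`-function, as `(1 / 2πi) ∫ … ds` along the upward vertical line `Re s = C`
(`s = C + it`, `ds = i dt`). -/
noncomputable def meijerG {p q : ℕ} (m n : ℕ) (a : Fin p → ℂ) (b : Fin q → ℂ)
    (C : ℝ) (z : ℂ) : ℂ :=
  (1 / (2 * Real.pi * Complex.I)) *
    ∫ t : ℝ, meijerGIntegrand m n a b z (C + t * Complex.I) * Complex.I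

/-- The lower parameters `(0)_k, 1/2 : (1/2)_{k-1}`: `k` zeros followed by `k` halves. -/
noncomputable def psiParam (k : ℕ) : Fin (2 * k) → ℂ :=
  fun j => if j.val < k then 0 else 1 / 2

/-- The `j`-th term of the series defining `Ψ_{ρ,k}(x)`:
`d_k(j) G^{k+1,0}_{0,2k}(— ; (0)_k, 1/2 : (1/2)_{k-1} | ρ² j² x² / 2^{2k})`,
the `G`-function being taken along the line `Re s = C`. -/
noncomputable def psiTerm (k : ℕ) (C ρ x : ℝ) (j : ℕ) : ℂ :=
  (piltzDivisor k j : ℂ) *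
    meijerG (k + 1) 0 (Fin.elim0 : Fin 0 → ℂ) (psiParam k) C
      ((ρ ^ 2 * (j : ℝ) ^ 2 * x ^ 2 / 2 ^ (2 * k) : ℝ) : ℂ)

/-- `Ψ_{ρ,k}(x) = π^{k/2-1} / 2^{k-1} ∑_{j ≥ 1} d_k(j) G(…)`. -/
noncomputable def Psi (k : ℕ) (C ρ x : ℝ) : ℂ :=
  ((Real.pi ^ ((k : ℝ) / 2 - 1) / 2 ^ (k - 1) : ℝ) : ℂ) * ∑' j : ℕ+, psiTerm k C ρ x j

/-- The function of `s` whose `(k-1)`-th derivative at `0` is taken. -/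
noncomputable def eisensteinKernel (k m : ℕ) (α β : ℝ) (s : ℂ) : ℂ :=
  riemannZeta (1 - 2 * m + s) ^ k * riemannZeta s ^ k * Complex.Gamma (s + 1) ^ k *
    Complex.cos (Real.pi * s / 2) ^ (k - 1) * (2 : ℂ) ^ (-(k : ℂ) * s) *
    ((α : ℂ) ^ (-(k : ℂ) * (s - m)) - (-1) ^ m * (β : ℂ) ^ (-(k : ℂ) * (s - m)))

open Complex MeasureTheory Filter Topology

/-! The formula is a contour shift for an integrand that is odd about `Re w = m`.

With `s = -w/2`, the reflection and duplication formulas turn the Mellin–Barnes integrand of `G_k`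
into a constant times `Γ(w)^k cos(πw/2)^(k-1) Y^(-w)` (`meijerGIntegrand_eq_psiMellin`). Since `∑
d_k(n) n^(-s) = ζ(s)^k`, summing over `j` and `n` under the integral sign (`hasSum_eisenstein`,
`eisenstein_eq_integral`) shows that `α^(km)` times the first series is `(1/2πi) ∫ E_α(w) dw` along
`Re w = c > 2m`, where `E_α(w) = Γ(w)^k cos(πw/2)^(k-1) ζ(w)^k ζ(w+1-2m)^k 2^(-kw) α^(-k(w-m))`.

The functional equation of `ζ` and `αβ = π²` give `E_α(2m-w) = (-1)^m E_β(w)`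
(`eisensteinSymm_reflect`). So `D = E_α - (-1)^m E_β`, whose integral is the left-hand side,
satisfies `D(2m-w) = -D(w)`, and its integral over `Re w = m` vanishes
(`integral_eisensteinOdd_eq_zero`). Moving the line from `c` to `m` meets only the singularity at `w
= 2m`, of order at most `k`: the pole of `ζ(w)` at `1` stays to the left because `m > 1`. The
left-hand side is therefore the residue of `D` at `2m`. By oddness this is also its residue at `0`,
where `s^k D(s)` is the function in braces (`eisensteinKernel_eq`).

The shift is legitimate because the decay of `Γ^k` beats the growth of `cos^(k-1)`
(`exists_decay_angle`), while `ζ` grows subexponentially in vertical strips. -/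

/-! ### Exponential bounds in vertical strips. -/

/-- `f` grows at most like `exp (d |Im s|)` in the vertical strip `a ≤ Re s ≤ b`, away from the
real axis. -/
def ExpBoundedOnStrip (f : ℂ → ℂ) (a b d : ℝ) : Prop :=
  ∃ M : ℝ, ∀ s : ℂ, a ≤ s.re → s.re ≤ b → 1 ≤ |s.im| → ‖f s‖ ≤ M * Real.exp (d * |s.im|)

namespace ExpBoundedOnStrip

lemma mono_left {f : ℂ → ℂ} {a b d a' b' : ℝ} (h : ExpBoundedOnStrip f a b d) (ha : a ≤ a')
    (hb : b' ≤ b) : ExpBoundedOnStrip f a' b' d := by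
  obtain ⟨M, hM⟩ := h
  exact ⟨M, fun s h1 h2 h3 => hM s (ha.trans h1) (h2.trans hb) h3⟩

lemma mul {f g : ℂ → ℂ} {a b d e : ℝ} (hf : ExpBoundedOnStrip f a b d)
    (hg : ExpBoundedOnStrip g a b e) : ExpBoundedOnStrip (fun s => f s * g s) a b (d + e) := by
  obtain ⟨M, hM⟩ := hf
  obtain ⟨N, hN⟩ := hg
  refine ⟨M * N, fun s h1 h2 h3 => ?_⟩
  rw [norm_mul, add_mul, Real.exp_add]
  calc ‖f s‖ * ‖g s‖ ≤ (M * Real.exp (d * |s.im|)) * (N * Real.exp (e * |s.im|)) :=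
        mul_le_mul (hM s h1 h2 h3) (hN s h1 h2 h3) (norm_nonneg _)
          ((norm_nonneg _).trans (hM s h1 h2 h3))
    _ = _ := by ring

lemma pow {f : ℂ → ℂ} {a b d : ℝ} (hf : ExpBoundedOnStrip f a b d) (n : ℕ) :
    ExpBoundedOnStrip (fun s => f s ^ n) a b (n * d) := by
  obtain ⟨M, hM⟩ := hf
  refine ⟨M ^ n, fun s h1 h2 h3 => ?_⟩
  rw [norm_pow, mul_assoc, Real.exp_nat_mul, ← mul_pow]
  exact pow_le_pow_left₀ (norm_nonneg _) (hM s h1 h2 h3) n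

lemma sub {f g : ℂ → ℂ} {a b d : ℝ} (hf : ExpBoundedOnStrip f a b d)
    (hg : ExpBoundedOnStrip g a b d) : ExpBoundedOnStrip (fun s => f s - g s) a b d := by
  obtain ⟨M, hM⟩ := hf
  obtain ⟨N, hN⟩ := hg
  refine ⟨M + N, fun s h1 h2 h3 => (norm_sub_le _ _).trans ?_⟩
  rw [add_mul]
  exact add_le_add (hM s h1 h2 h3) (hN s h1 h2 h3)

lemma mono_exp {f : ℂ → ℂ} {a b d e : ℝ} (hf : ExpBoundedOnStrip f a b d) (hde : d ≤ e) :
    ExpBoundedOnStrip f a b e := by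
  obtain ⟨M, hM⟩ := hf
  refine ⟨|M|, fun s h1 h2 h3 => (hM s h1 h2 h3).trans ?_⟩
  gcongr
  exact le_abs_self M

lemma congr {f g : ℂ → ℂ} {a b d : ℝ} (hf : ExpBoundedOnStrip f a b d)
    (h : ∀ s : ℂ, a ≤ s.re → s.re ≤ b → 1 ≤ |s.im| → g s = f s) :
    ExpBoundedOnStrip g a b d := by
  obtain ⟨M, hM⟩ := hf
  exact ⟨M, fun s h1 h2 h3 => h s h1 h2 h3 ▸ hM s h1 h2 h3⟩

lemma const_mul {f : ℂ → ℂ} {a b d : ℝ} (hf : ExpBoundedOnStrip f a b d) (c : ℂ) :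
    ExpBoundedOnStrip (fun s => c * f s) a b d := by
  obtain ⟨M, hM⟩ := hf
  refine ⟨‖c‖ * M, fun s h1 h2 h3 => ?_⟩
  rw [norm_mul, mul_assoc]
  gcongr
  exact hM s h1 h2 h3

end ExpBoundedOnStrip

lemma integrable_exp_mul_abs_of_neg {d : ℝ} (hd : d < 0) :
    Integrable (fun t : ℝ => Real.exp (d * |t|)) := by
  have h := exp_neg_integrableOn_Ioi 0 (neg_pos.2 hd)
  simp only [neg_neg] at h
  have h1 : IntegrableOn (fun t : ℝ => Real.exp (d * |t|)) (Set.Ioi 0) :=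
    h.congr_fun (fun t ht => by simp [abs_of_pos (Set.mem_Ioi.1 ht)]) measurableSet_Ioi
  have h2 : IntegrableOn (fun t : ℝ => Real.exp (d * |t|)) (Set.Iio 0) := by
    rw [← integrable_indicator_iff measurableSet_Ioi] at h1
    rw [← integrable_indicator_iff measurableSet_Iio]
    refine h1.comp_neg.congr (Eventually.of_forall fun t => ?_)
    simp [Set.indicator_apply]
  rw [← integrableOn_univ, ← Set.Iio_union_Ici (a := (0 : ℝ)), integrableOn_union,
    integrableOn_Ici_iff_integrableOn_Ioi]
  exact ⟨h2, h1⟩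

lemma integrable_of_norm_le_exp {φ : ℝ → ℂ} (hφ : Continuous φ) {M d : ℝ} (hd : d < 0)
    (h : ∀ t, 1 ≤ |t| → ‖φ t‖ ≤ M * Real.exp (d * |t|)) : Integrable φ := by
  obtain ⟨B, hB⟩ := (isCompact_Icc (a := (-1 : ℝ)) (b := 1)).exists_bound_of_continuousOn
    hφ.continuousOn
  refine Integrable.mono' (g := fun t => (|M| + |B| * Real.exp (-d)) * Real.exp (d * |t|))
    ((integrable_exp_mul_abs_of_neg hd).const_mul _) hφ.aestronglyMeasurable
    (Eventually.of_forall fun t => ?_)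
  rw [add_mul]
  rcases le_or_gt 1 |t| with ht | ht
  · refine (h t ht).trans ?_
    have : 0 ≤ |B| * Real.exp (-d) * Real.exp (d * |t|) := by positivity
    have := mul_le_mul_of_nonneg_right (le_abs_self M) (Real.exp_pos (d * |t|)).le
    linarith
  · have h1 : ‖φ t‖ ≤ |B| := (hB t (abs_le.1 ht.le)).trans (le_abs_self B)
    have h2 : 1 ≤ Real.exp (-d) * Real.exp (d * |t|) := by
      rw [← Real.exp_add]
      exact Real.one_le_exp (by nlinarith)
    have h3 : 0 ≤ |M| * Real.exp (d * |t|) := by positivity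
    have := mul_le_mul_of_nonneg_left h2 (abs_nonneg B)
    nlinarith

lemma continuous_vertical_line {f : ℂ → ℂ} {S : Set ℂ} (hf : ContinuousOn f S) {c : ℝ}
    (hc : ∀ t : ℝ, (c : ℂ) + t * I ∈ S) : Continuous fun t : ℝ => f (c + t * I) :=
  hf.comp_continuous (by fun_prop) hc

lemma ExpBoundedOnStrip.integrable_line {f : ℂ → ℂ} {a b d c : ℝ} (h : ExpBoundedOnStrip f a b d)
    (hd : d < 0) (hac : a ≤ c) (hcb : c ≤ b) (hf : Continuous fun t : ℝ => f (c + t * I)) :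
    Integrable fun t : ℝ => f (c + t * I) := by
  obtain ⟨M, hM⟩ := h
  refine integrable_of_norm_le_exp hf hd (M := M) fun t ht => ?_
  simpa using hM (c + t * I) (by simpa) (by simpa) (by simpa)

/-! ### Shifting vertical lines of integration. -/

/-- `f` tends to zero uniformly on horizontal segments of the strip, as `|Im s| → ∞`. -/
def VanishesOnHorizontals (f : ℂ → ℂ) (a b : ℝ) : Prop :=
  ∃ B : ℝ → ℝ, Tendsto B atTop (𝓝 0) ∧
    ∀ s : ℂ, a ≤ s.re → s.re ≤ b → 1 ≤ |s.im| → ‖f s‖ ≤ B |s.im|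

lemma ExpBoundedOnStrip.vanishesOnHorizontals {f : ℂ → ℂ} {a b d : ℝ}
    (h : ExpBoundedOnStrip f a b d) (hd : d < 0) : VanishesOnHorizontals f a b := by
  obtain ⟨M, hM⟩ := h
  refine ⟨fun t => M * Real.exp (d * t), ?_, hM⟩
  have : Tendsto (fun t : ℝ => Real.exp (d * t)) atTop (𝓝 0) :=
    Real.tendsto_exp_atBot.comp (tendsto_id.const_mul_atTop_of_neg hd)
  simpa using this.const_mul M

lemma VanishesOnHorizontals.sub {f g : ℂ → ℂ} {a b : ℝ} (hf : VanishesOnHorizontals f a b)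
    (hg : VanishesOnHorizontals g a b) : VanishesOnHorizontals (fun s => f s - g s) a b := by
  obtain ⟨B, hB, h⟩ := hf
  obtain ⟨B', hB', h'⟩ := hg
  exact ⟨fun t => B t + B' t, by simpa using hB.add hB', fun s h1 h2 h3 =>
    (norm_sub_le _ _).trans (add_le_add (h s h1 h2 h3) (h' s h1 h2 h3))⟩

lemma VanishesOnHorizontals.congr {f g : ℂ → ℂ} {a b : ℝ} (hf : VanishesOnHorizontals f a b)
    (h : ∀ s : ℂ, a ≤ s.re → s.re ≤ b → 1 ≤ |s.im| → g s = f s) :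
    VanishesOnHorizontals g a b := by
  obtain ⟨M, h0, hM⟩ := hf
  exact ⟨M, h0, fun s h1 h2 h3 => h s h1 h2 h3 ▸ hM s h1 h2 h3⟩

/-- The difference of the truncated integrals over the sides of a strip. -/
noncomputable def stripDiff (f : ℂ → ℂ) (a b T : ℝ) : ℂ :=
  (∫ t in -T..T, f (b + t * I)) - ∫ t in -T..T, f (a + t * I)

lemma tendsto_stripDiff_zero {f : ℂ → ℂ} {a b : ℝ} (hab : a ≤ b)
    (hf : DifferentiableOn ℂ f (re ⁻¹' Set.Icc a b)) (hv : VanishesOnHorizontals f a b) :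
    Tendsto (stripDiff f a b) atTop (𝓝 0) := by
  obtain ⟨B, hB, h⟩ := hv
  have key : ∀ᶠ T : ℝ in atTop, ‖stripDiff f a b T‖ ≤ 2 * (B T * (b - a)) := by
    filter_upwards [eventually_ge_atTop 1] with T hT
    have h0 := integral_boundary_rect_eq_zero_of_differentiableOn f (a - T * I) (b + T * I)
      (hf.mono fun s hs => by
        have := (Set.mem_preimage.1 hs.1)
        simpa [Set.uIcc_of_le hab] using this)
    simp only [sub_re, ofReal_re, mul_re, I_re, mul_zero, ofReal_im, I_im, mul_one, sub_self,
      sub_zero, add_re, add_zero, sub_im, mul_im, zero_sub, add_im, zero_add,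
      smul_eq_mul, ofReal_neg] at h0
    have h1 : stripDiff f a b T = I * ((∫ x in a..b, f (x + -T * I)) -
        ∫ x in a..b, f (x + T * I)) := by
      have hI := I_mul_I
      unfold stripDiff
      linear_combination (-I) * h0 + ((∫ t in -T..T, f (b + t * I)) -
        ∫ t in -T..T, f (a + t * I)) * hI
    have hbd : ∀ y : ℝ, |y| = T → ‖∫ x in a..b, f (x + y * I)‖ ≤ B T * (b - a) := by
      intro y hy
      have := intervalIntegral.norm_integral_le_of_norm_le_const (a := a) (b := b) (C := B T)
        (f := fun x : ℝ => f (x + y * I)) (fun x hx => by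
          rw [Set.uIoc_of_le hab] at hx
          have := h (x + y * I) (by simpa using hx.1.le) (by simpa using hx.2) (by simpa [hy])
          simpa [hy] using this)
      rwa [abs_of_nonneg (by linarith)] at this
    rw [h1, norm_mul, norm_I, one_mul, two_mul]
    refine (norm_sub_le _ _).trans (add_le_add ?_ ?_)
    · simpa using hbd (-T) (by simp [abs_of_nonneg (by linarith : (0:ℝ) ≤ T)])
    · exact hbd T (by simp [abs_of_nonneg (by linarith : (0:ℝ) ≤ T)])
  refine squeeze_zero_norm' key ?_
  simpa using (hB.mul_const (b - a)).const_mul 2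

lemma tendsto_stripDiff_of_integrable {f : ℂ → ℂ} {a b : ℝ}
    (ha : Integrable fun t : ℝ => f (a + t * I)) (hb : Integrable fun t : ℝ => f (b + t * I)) :
    Tendsto (stripDiff f a b) atTop
      (𝓝 ((∫ t : ℝ, f (b + t * I)) - ∫ t : ℝ, f (a + t * I))) :=
  (intervalIntegral_tendsto_integral hb tendsto_neg_atTop_atBot tendsto_id).sub
    (intervalIntegral_tendsto_integral ha tendsto_neg_atTop_atBot tendsto_id)

/-- Integrals along the two sides of a strip agree for a holomorphic function that decays
exponentially. -/
lemma ExpBoundedOnStrip.integral_eq {f : ℂ → ℂ} {a b d : ℝ} (hab : a ≤ b)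
    (hf : DifferentiableOn ℂ f (re ⁻¹' Set.Icc a b)) (h : ExpBoundedOnStrip f a b d)
    (hd : d < 0) : ∫ t : ℝ, f (b + t * I) = ∫ t : ℝ, f (a + t * I) := by
  have ha := h.integrable_line hd le_rfl hab
    (continuous_vertical_line hf.continuousOn (by simpa using hab))
  have hb := h.integrable_line hd hab le_rfl
    (continuous_vertical_line hf.continuousOn (by simpa using hab))
  exact sub_eq_zero.1 (tendsto_nhds_unique (tendsto_stripDiff_of_integrable ha hb)
    (tendsto_stripDiff_zero hab hf (h.vanishesOnHorizontals hd)))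

/-! ### The residue at a pole of arbitrary order inside a strip. -/

lemma line_sub_ne_zero {c p : ℝ} (hc : c ≠ p) (t : ℝ) : (c : ℂ) + t * I - p ≠ 0 := by
  intro h
  have := congrArg re h
  simp [sub_eq_zero, hc] at this

lemma vanishesOnHorizontals_inv_pow (a b p : ℝ) (n : ℕ) :
    VanishesOnHorizontals (fun s => 1 / (s - p) ^ (n + 1)) a b := by
  refine ⟨fun t => 1 / t, by simpa using tendsto_inv_atTop_zero, fun s _ _ h3 => ?_⟩
  have h4 : |s.im| ≤ ‖s - p‖ := by simpa using abs_im_le_norm (s - p)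
  rw [norm_div, norm_one, norm_pow]
  refine one_div_le_one_div_of_le (by linarith) (h4.trans ?_)
  exact le_self_pow₀ (h3.trans h4) (by omega)

/-- A power of exponent at least two has a single-valued primitive that vanishes at both ends of the
line, so the polar terms of order above one contribute nothing. -/
lemma tendsto_integral_inv_pow {c p : ℝ} (hc : c ≠ p) (n : ℕ) :
    Tendsto (fun T : ℝ => ∫ t in -T..T, 1 / ((c : ℂ) + t * I - p) ^ (n + 2)) atTop (𝓝 0) := by
  have hne := line_sub_ne_zero hc
  set F : ℝ → ℂ := fun t => I / ((n + 1) * ((c : ℂ) + t * I - p) ^ (n + 1)) with hF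
  have hn : (n + 1 : ℂ) ≠ 0 := by exact_mod_cast n.succ_ne_zero
  have hder : ∀ t : ℝ, HasDerivAt F (1 / ((c : ℂ) + t * I - p) ^ (n + 2)) t := by
    intro t
    have h1 : HasDerivAt (fun t : ℝ => (c : ℂ) + t * I - p) I t := by
      simpa using ((ofRealCLM.hasDerivAt (x := t)).mul_const I).const_add (c : ℂ) |>.sub_const (p:ℂ)
    have h2 := ((h1.pow (n + 1)).const_mul (n + 1 : ℂ)).inv
      (mul_ne_zero hn (pow_ne_zero _ (hne t))) |>.const_mul I
    refine (h2.congr_deriv ?_)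
    have := hne t
    simp only [Pi.pow_apply, Nat.add_sub_cancel]
    push_cast
    generalize (c : ℂ) + t * I - p = X at this
    rw [← mul_div_assoc, show I * -((n + 1 : ℂ) * ((n + 1) * X ^ n * I)) = (n + 1) ^ 2 * X ^ n by
      linear_combination (-(n + 1 : ℂ) ^ 2 * X ^ n) * I_mul_I]
    field_simp
    ring
  have hint : ∀ T : ℝ, ∫ t in -T..T, 1 / ((c : ℂ) + t * I - p) ^ (n + 2) = F T - F (-T) :=
    fun T => intervalIntegral.integral_eq_sub_of_hasDerivAt (fun t _ => hder t)
      (Continuous.intervalIntegrable (by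
        exact continuous_const.div (by fun_prop) fun t => pow_ne_zero _ (hne t)) _ _)
  simp_rw [hint]
  obtain ⟨B, hB, hb⟩ := vanishesOnHorizontals_inv_pow c c p n
  have hFb : ∀ t : ℝ, 1 ≤ |t| → ‖F t‖ ≤ B |t| := by
    intro t ht
    refine le_trans ?_ (by simpa using hb (c + t * I) (by simp) (by simp) (by simpa))
    have h1 : (1 : ℝ) ≤ ‖(n + 1 : ℂ)‖ := by
      have : (n + 1 : ℂ) = ((n + 1 : ℕ) : ℂ) := by push_cast; rfl
      rw [this, Complex.norm_natCast]; push_cast; linarith [n.cast_nonneg (α := ℝ)]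
    have h2 : 0 < ‖(c : ℂ) + t * I - p‖ ^ (n + 1) := pow_pos (norm_pos_iff.2 (hne t)) _
    simp only [hF, norm_div, norm_I, norm_mul, norm_pow, ← one_div]
    exact one_div_le_one_div_of_le h2 (le_mul_of_one_le_left h2.le h1)
  have hzero : Tendsto (fun T : ℝ => B T + B T) atTop (𝓝 0) := by simpa using hB.add hB
  refine squeeze_zero_norm' ?_ hzero
  filter_upwards [eventually_ge_atTop 1] with T hT
  have habs : |T| = T := abs_of_nonneg (by linarith)
  refine (norm_sub_le _ _).trans (add_le_add ?_ ?_)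
  · simpa [habs] using hFb T (by simpa [habs])
  · simpa [habs] using hFb (-T) (by simpa [habs])

/-- Folding `t` onto `-t` leaves the integrand `2(c-p)/((c-p)² + t²)`, whose primitive is an
arctangent. The symmetric truncation is essential: `1/(s-p)` is not absolutely integrable on the
line. -/
lemma integral_inv_line {c p : ℝ} (hc : c ≠ p) (T : ℝ) :
    ∫ t in -T..T, 1 / ((c : ℂ) + t * I - p) = ((2 * Real.arctan (T / (c - p)) : ℝ) : ℂ) := by
  have hcp : c - p ≠ 0 := sub_ne_zero.2 hc
  have hcont : Continuous fun t : ℝ => 1 / ((c : ℂ) + t * I - p) :=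
    continuous_const.div (by fun_prop) (line_sub_ne_zero hc)
  have hsym : ∫ t in -T..T, 1 / ((c : ℂ) + t * I - p) =
      ∫ t in (0 : ℝ)..T, (1 / ((c : ℂ) + t * I - p) + 1 / ((c : ℂ) + (-t : ℝ) * I - p)) := by
    have hneg : ∫ t in -T..(0:ℝ), 1 / ((c : ℂ) + t * I - p) =
        ∫ t in (0 : ℝ)..T, 1 / ((c : ℂ) + (-t : ℝ) * I - p) := by
      rw [intervalIntegral.integral_comp_neg (fun t : ℝ => 1 / ((c : ℂ) + t * I - p))]
      simp
    rw [← intervalIntegral.integral_add_adjacent_intervals (hcont.intervalIntegrable (-T) 0)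
      (hcont.intervalIntegrable 0 T), hneg, add_comm]
    exact (intervalIntegral.integral_add (hcont.intervalIntegrable 0 T)
      ((hcont.comp continuous_neg).intervalIntegrable 0 T)).symm
  have hder : ∀ t : ℝ, HasDerivAt (fun t : ℝ => ((2 * Real.arctan (t / (c - p)) : ℝ) : ℂ))
      (1 / ((c : ℂ) + t * I - p) + 1 / ((c : ℂ) + (-t : ℝ) * I - p)) t := by
    intro t
    have h1 := (((hasDerivAt_id t).div_const (c - p)).arctan.const_mul 2).ofReal_comp
    refine h1.congr_deriv ?_
    have e1 := line_sub_ne_zero hc t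
    have e2 := line_sub_ne_zero hc (-t)
    have e3 : ((c - p) ^ 2 + t ^ 2 : ℝ) ≠ 0 := by positivity
    have e4 : (1 + (t / (c - p)) ^ 2 : ℝ) ≠ 0 := by positivity
    have e5 : ((c : ℂ) + t * I - p) * ((c : ℂ) + (-t : ℝ) * I - p) =
        (((c - p) ^ 2 + t ^ 2 : ℝ) : ℂ) := by
      push_cast
      linear_combination (-(t : ℂ) ^ 2) * I_sq
    have e6 : 2 * (1 / (1 + (id t / (c - p)) ^ 2) * (1 / (c - p))) =
        2 * (c - p) / ((c - p) ^ 2 + t ^ 2) := by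
      simp only [id]
      field_simp
    rw [e6, div_add_div _ _ e1 e2, e5]
    push_cast
    congr 1
    ring
  rw [hsym, intervalIntegral.integral_eq_sub_of_hasDerivAt (fun t _ => hder t)]
  · simp
  · exact (hcont.add (hcont.comp continuous_neg)).intervalIntegrable _ _

lemma tendsto_stripDiff_inv {a b p : ℝ} (hap : a < p) (hpb : p < b) :
    Tendsto (stripDiff (fun s => 1 / (s - p)) a b) atTop (𝓝 (2 * Real.pi)) := by
  have hb : Tendsto (fun T : ℝ => 2 * Real.arctan (T / (b - p))) atTop (𝓝 (2 * (Real.pi / 2))) :=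
    ((tendsto_nhds_of_tendsto_nhdsWithin Real.tendsto_arctan_atTop).comp
      (tendsto_id.atTop_div_const (sub_pos.2 hpb))).const_mul 2
  have ha : Tendsto (fun T : ℝ => 2 * Real.arctan (T / (a - p))) atTop
      (𝓝 (2 * (-(Real.pi / 2)))) :=
    ((tendsto_nhds_of_tendsto_nhdsWithin Real.tendsto_arctan_atBot).comp
      (tendsto_id.atTop_div_const_of_neg (sub_neg.2 hap))).const_mul 2
  have h := (continuous_ofReal.tendsto _).comp (hb.sub ha)
  have e : ((2 * (Real.pi / 2) - 2 * (-(Real.pi / 2)) : ℝ) : ℂ) = 2 * Real.pi := by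
    push_cast; ring
  rw [e] at h
  refine h.congr fun T => ?_
  simp only [stripDiff, integral_inv_line hpb.ne', integral_inv_line hap.ne, Function.comp_apply,
    ofReal_sub]

/-- Passing from `K` to `(K(s) - K(p))/(s - p)` shifts the Taylor coefficients at `p` by one. This
drives the induction on the order of the pole. -/
lemma iteratedDeriv_dslope_div_factorial {K : ℂ → ℂ} {p : ℂ} (hK : AnalyticAt ℂ K p) (n : ℕ) :
    iteratedDeriv n (dslope K p) p / n.factorial =
      iteratedDeriv (n + 1) K p / (n + 1).factorial := by
  have h1 := hK.hasFPowerSeriesAt.has_fpower_series_dslope_fslope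
  have h2 := h1.eq_formalMultilinearSeries h1.analyticAt.hasFPowerSeriesAt
  have h3 := congrArg (fun q => FormalMultilinearSeries.coeff q n) h2
  simp only [FormalMultilinearSeries.coeff_fslope, FormalMultilinearSeries.coeff_ofScalars] at h3
  exact h3.symm

lemma stripDiff_add {f g h : ℂ → ℂ} {a b T : ℝ} (hfgh : ∀ s : ℂ, s.re = a ∨ s.re = b →
    h s = f s + g s)
    (hfa : Continuous fun t : ℝ => f (a + t * I)) (hfb : Continuous fun t : ℝ => f (b + t * I))
    (hga : Continuous fun t : ℝ => g (a + t * I)) (hgb : Continuous fun t : ℝ => g (b + t * I)) :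
    stripDiff h a b T = stripDiff f a b T + stripDiff g a b T := by
  have h1 : ∀ t : ℝ, h (a + t * I) = f (a + t * I) + g (a + t * I) :=
    fun t => hfgh _ (Or.inl (by simp))
  have h2 : ∀ t : ℝ, h (b + t * I) = f (b + t * I) + g (b + t * I) :=
    fun t => hfgh _ (Or.inr (by simp))
  simp only [stripDiff, h1, h2]
  rw [intervalIntegral.integral_add (hfa.intervalIntegrable _ _) (hga.intervalIntegrable _ _),
    intervalIntegral.integral_add (hfb.intervalIntegrable _ _) (hgb.intervalIntegrable _ _)]
  ring

lemma stripDiff_const_mul (f : ℂ → ℂ) (c : ℂ) (a b T : ℝ) :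
    stripDiff (fun s => c * f s) a b T = c * stripDiff f a b T := by
  simp only [stripDiff, intervalIntegral.integral_const_mul, mul_sub]

lemma continuous_line_div_pow {K : ℂ → ℂ} {a b p c : ℝ}
    (hK : DifferentiableOn ℂ K (re ⁻¹' Set.Icc a b)) (hac : a ≤ c) (hcb : c ≤ b) (hc : c ≠ p)
    (n : ℕ) : Continuous fun t : ℝ => K (c + t * I) / ((c : ℂ) + t * I - p) ^ n :=
  (continuous_vertical_line hK.continuousOn (by simp [hac, hcb])).div (by fun_prop)
    fun t => pow_ne_zero _ (line_sub_ne_zero hc t)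

/-- The residue theorem for a strip containing one pole. -/
lemma tendsto_stripDiff_pole {a b p : ℝ} (hap : a < p) (hpb : p < b) (n : ℕ) :
    ∀ K : ℂ → ℂ, DifferentiableOn ℂ K (re ⁻¹' Set.Icc a b) →
    VanishesOnHorizontals (fun s => K s / (s - p) ^ (n + 1)) a b →
    Tendsto (stripDiff (fun s => K s / (s - p) ^ (n + 1)) a b) atTop
      (𝓝 (2 * Real.pi * (iteratedDeriv n K p / n.factorial))) := by
  have hmem : re ⁻¹' Set.Icc a b ∈ 𝓝 (p : ℂ) :=
    continuous_re.continuousAt.preimage_mem_nhds (by simpa using Icc_mem_nhds hap hpb)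
  have hab := (hap.trans hpb).le
  -- Peel off the top polar term; what remains has a pole of order one less, with `dslope K p` as
  -- its numerator.
  have hsplit : ∀ (m : ℕ) (K : ℂ → ℂ) (s : ℂ), s ≠ p → K s / (s - p) ^ (m + 1) =
      K p * (1 / (s - p) ^ (m + 1)) + dslope K p s / (s - p) ^ m := by
    intro m K s hs
    have hs' : s - p ≠ 0 := sub_ne_zero.2 hs
    rw [dslope_of_ne _ hs, slope_def_field, pow_succ]
    field_simp
    ring
  have hne : ∀ s : ℂ, s.re = a ∨ s.re = b → s ≠ p := by
    rintro s (h | h) rfl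
    · exact hap.ne' (by simpa using h)
    · exact hpb.ne (by simpa using h)
  have hne' : ∀ s : ℂ, 1 ≤ |s.im| → s ≠ p := by
    rintro s h rfl
    simp at h
    linarith
  have hone : DifferentiableOn ℂ (fun _ : ℂ => (1 : ℂ)) (re ⁻¹' Set.Icc a b) :=
    differentiableOn_const _
  have hvan : ∀ (m : ℕ) (K : ℂ → ℂ), VanishesOnHorizontals (fun s => K s / (s - p) ^ (m + 1)) a b →
      VanishesOnHorizontals (fun s => dslope K p s / (s - p) ^ m) a b := by
    intro m K hv
    obtain ⟨B, hB, h⟩ := vanishesOnHorizontals_inv_pow a b p m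
    have hv2 : VanishesOnHorizontals (fun s => K p * (1 / (s - p) ^ (m + 1))) a b :=
      ⟨fun t => ‖K p‖ * B t, by simpa using hB.const_mul ‖K p‖, fun s h1 h2 h3 => by
        rw [norm_mul]; exact mul_le_mul_of_nonneg_left (h s h1 h2 h3) (norm_nonneg _)⟩
    exact (hv.sub hv2).congr fun s _ _ h3 => by rw [hsplit m K s (hne' s h3)]; ring
  have hdiff : ∀ (m : ℕ) (K : ℂ → ℂ), DifferentiableOn ℂ K (re ⁻¹' Set.Icc a b) → ∀ T,
      stripDiff (fun s => K s / (s - p) ^ (m + 1)) a b T =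
      K p * stripDiff (fun s => 1 / (s - p) ^ (m + 1)) a b T +
        stripDiff (fun s => dslope K p s / (s - p) ^ m) a b T := by
    intro m K hK T
    have hD := (differentiableOn_dslope hmem).2 hK
    rw [← stripDiff_const_mul]
    exact stripDiff_add (fun s hs => hsplit m K s (hne s hs))
      ((continuous_line_div_pow hone le_rfl hab hap.ne _).const_mul _)
      ((continuous_line_div_pow hone hab le_rfl hpb.ne' _).const_mul _)
      (continuous_line_div_pow hD le_rfl hab hap.ne _)
      (continuous_line_div_pow hD hab le_rfl hpb.ne' _)
  induction n with
  | zero =>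
    intro K hK hv
    have hD := (differentiableOn_dslope hmem).2 hK
    have h1 := tendsto_stripDiff_zero hab (by simpa using hD) (hvan 0 K hv)
    have h2 := ((tendsto_stripDiff_inv hap hpb).const_mul (K p)).add h1
    simp only [zero_add, pow_one] at hdiff ⊢
    refine Tendsto.congr' (Eventually.of_forall fun T => ?_) (h2.trans_eq (by simp; ring_nf))
    have := hdiff 0 K hK T
    simp only [zero_add, pow_one] at this
    exact this.symm
  | succ n ih =>
    intro K hK hv
    have hD := (differentiableOn_dslope hmem).2 hK
    have h1 := ih _ hD (hvan (n + 1) K hv)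
    rw [iteratedDeriv_dslope_div_factorial (hK.analyticAt hmem)] at h1
    have h0 : Tendsto (stripDiff (fun s => 1 / (s - p) ^ (n + 1 + 1)) a b) atTop (𝓝 0) := by
      have h := (tendsto_integral_inv_pow hpb.ne' n).sub (tendsto_integral_inv_pow hap.ne n)
      rw [sub_zero] at h
      exact h
    have h2 := (h0.const_mul (K p)).add h1
    rw [mul_zero, zero_add] at h2
    exact h2.congr fun T => (hdiff (n + 1) K hK T).symm

/-! ### Exponential decay of the Gamma function. -/

lemma eqOn_halfPlane_of_eq_real {f g : ℂ → ℂ} {c : ℝ} (hf : DifferentiableOn ℂ f {s | c < s.re})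
    (hg : DifferentiableOn ℂ g {s | c < s.re}) {x₀ : ℝ} (hx₀ : c < x₀)
    (h : ∀ᶠ x : ℝ in 𝓝 x₀, f x = g x) : Set.EqOn f g {s | c < s.re} := by
  have hopen : IsOpen {s : ℂ | c < s.re} := isOpen_lt continuous_const continuous_re
  refine (hf.analyticOnNhd hopen).eqOn_of_preconnected_of_frequently_eq (hg.analyticOnNhd hopen)
    (convex_halfSpace_re_gt c).isPreconnected (z₀ := (x₀ : ℂ)) (by simpa) ?_
  have hmap : Tendsto (fun x : ℝ => (x : ℂ)) (𝓝[≠] x₀) (𝓝[≠] (x₀ : ℂ)) :=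
    tendsto_nhdsWithin_of_tendsto_nhds_of_eventually_within _
      (continuous_ofReal.continuousAt.tendsto.mono_left nhdsWithin_le_nhds)
      (eventually_mem_nhdsWithin.mono fun x hx => by simpa using hx)
  exact hmap.frequently (h.filter_mono nhdsWithin_le_nhds).frequently

lemma integrableOn_rpow_mul_exp_neg {σ b : ℝ} (hσ : 0 < σ) (hb : 0 < b) :
    IntegrableOn (fun x : ℝ => x ^ (σ - 1) * Real.exp (-(b * x))) (Set.Ioi 0) := by
  simpa using integrableOn_rpow_mul_exp_neg_mul_rpow (s := σ - 1) (p := 1) (by linarith)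
    one_pos hb

lemma norm_cpow_mul_exp_neg {x : ℝ} (hx : 0 < x) (a r : ℂ) :
    ‖(x : ℂ) ^ (a - 1) * cexp (-(r * x))‖ = x ^ (a.re - 1) * Real.exp (-(r.re * x)) := by
  rw [norm_mul, norm_cpow_eq_rpow_re_of_pos hx, Complex.norm_exp]
  simp

lemma aestronglyMeasurable_cpow_mul_exp (a r : ℂ) : AEStronglyMeasurable
    (fun x : ℝ => (x : ℂ) ^ (a - 1) * cexp (-(r * x))) (volume.restrict (Set.Ioi 0)) := by
  refine ContinuousOn.aestronglyMeasurable (fun x hx => ContinuousAt.continuousWithinAt ?_)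
    measurableSet_Ioi
  refine (continuousAt_ofReal_cpow_const _ _ (Or.inr (ne_of_gt hx))).mul ?_
  fun_prop

lemma differentiableOn_integral_cpow_mul_exp {a : ℂ} (ha : 0 < a.re) :
    DifferentiableOn ℂ (fun r : ℂ => ∫ x in Set.Ioi (0 : ℝ), (x : ℂ) ^ (a - 1) * cexp (-(r * x)))
      {r | 0 < r.re} := by
  intro r₀ hr₀
  have hr₀' : 0 < r₀.re := hr₀
  have hs : {r : ℂ | r₀.re / 2 < r.re} ∈ 𝓝 r₀ :=
    (isOpen_lt continuous_const continuous_re).mem_nhds (by simp; linarith)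
  have hpow : ∀ x : ℝ, 0 < x → (x : ℂ) ^ (a - 1) * x = (x : ℂ) ^ (a + 1 - 1) := fun x hx => by
    have : (x : ℂ) ≠ 0 := by exact_mod_cast hx.ne'
    rw [cpow_sub _ _ this, cpow_one, add_sub_cancel_right]
    field_simp
  refine DifferentiableAt.differentiableWithinAt (HasDerivAt.differentiableAt
    (hasDerivAt_integral_of_dominated_loc_of_deriv_le
      (bound := fun x : ℝ => x ^ ((a.re + 1) - 1) * Real.exp (-(r₀.re / 2 * x)))
      (F' := fun (r : ℂ) (x : ℝ) => -((x : ℂ) ^ (a + 1 - 1) * cexp (-(r * x))))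
      hs (Eventually.of_forall fun r => aestronglyMeasurable_cpow_mul_exp a r) ?_
      (aestronglyMeasurable_cpow_mul_exp (a + 1) r₀).neg ?_
      (integrableOn_rpow_mul_exp_neg (by linarith) (by linarith)) ?_).2)
  · refine Integrable.mono' (integrableOn_rpow_mul_exp_neg ha hr₀')
      (aestronglyMeasurable_cpow_mul_exp a r₀) ?_
    filter_upwards [self_mem_ae_restrict measurableSet_Ioi] with x hx
    rw [norm_cpow_mul_exp_neg hx]
  · filter_upwards [self_mem_ae_restrict measurableSet_Ioi] with x hx r hr
    have hx' : (0 : ℝ) < x := hx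
    rw [norm_neg, norm_cpow_mul_exp_neg hx, add_re, one_re]
    have : r₀.re / 2 < r.re := hr
    gcongr
  · filter_upwards [self_mem_ae_restrict measurableSet_Ioi] with x hx r hr
    have h1 : HasDerivAt (fun r : ℂ => -(r * x)) (-(x : ℂ)) r := by
      simpa using! ((hasDerivAt_id r).mul_const (x : ℂ)).neg
    refine (h1.cexp.const_mul ((x : ℂ) ^ (a - 1))).congr_deriv ?_
    rw [← hpow x hx]
    ring

/-- Both sides are holomorphic in `r` on the right half-plane and agree for positive real `r`; the
identity theorem replaces a rotation of the contour. -/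
lemma integral_cpow_mul_exp_neg_complex {a r : ℂ} (ha : 0 < a.re) (hr : 0 < r.re) :
    ∫ x in Set.Ioi (0 : ℝ), (x : ℂ) ^ (a - 1) * cexp (-(r * x)) = r ^ (-a) * Gamma a := by
  refine eqOn_halfPlane_of_eq_real (c := 0) (differentiableOn_integral_cpow_mul_exp ha)
    (g := fun r => r ^ (-a) * Gamma a) ?_ (x₀ := 1) one_pos ?_ hr
  · intro r hr
    exact ((differentiableAt_id.cpow_const (Or.inl hr)).mul_const _).differentiableWithinAt
  · filter_upwards [lt_mem_nhds (one_pos : (0:ℝ) < 1)] with x hx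
    rw [integral_cpow_mul_exp_neg_mul_Ioi ha hx, one_div, cpow_neg, inv_cpow]
    rw [arg_ofReal_of_nonneg hx.le]
    exact Real.pi_pos.ne

/-- Take `r = e^(iφ)` in the rotated Euler integral: `|r^(-s)| = e^(φ Im s)` multiplies `|Γ(s)|`,
while absolute values inside the integral see only `Re r = cos φ` and leave a real Gamma integral.
Then `φ = ±θ`, with the sign of `Im s`. -/
lemma norm_Gamma_le {s : ℂ} (hs : 0 < s.re) {θ : ℝ} (h0 : 0 ≤ θ) (hθ : θ < Real.pi / 2) :
    ‖Gamma s‖ ≤ (1 / Real.cos θ) ^ s.re * Real.Gamma s.re * Real.exp (-θ * |s.im|) := by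
  have key : ∀ φ : ℝ, |φ| < Real.pi / 2 →
      Real.exp (φ * s.im) * ‖Gamma s‖ ≤ (1 / Real.cos φ) ^ s.re * Real.Gamma s.re := by
    intro φ hφ
    obtain ⟨h1, h2⟩ := abs_lt.1 hφ
    have hcos : 0 < Real.cos φ := Real.cos_pos_of_mem_Ioo ⟨by linarith, h2⟩
    have hre : (cexp (φ * I)).re = Real.cos φ := exp_ofReal_mul_I_re φ
    have hnorm : ‖cexp (φ * I) ^ (-s)‖ = Real.exp (φ * s.im) := by
      rw [cpow_def_of_ne_zero (exp_ne_zero _), log_exp, Complex.norm_exp]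
      · simp
      · simpa using by linarith [Real.pi_pos]
      · simpa using by linarith [Real.pi_pos]
    have := integral_cpow_mul_exp_neg_complex hs (r := cexp (φ * I)) (by rwa [hre])
    rw [← hnorm, ← norm_mul, ← this, ← Real.integral_rpow_mul_exp_neg_mul_Ioi hs hcos]
    refine norm_integral_le_of_norm_le (integrableOn_rpow_mul_exp_neg hs hcos) ?_
    filter_upwards [self_mem_ae_restrict measurableSet_Ioi] with x hx
    rw [norm_cpow_mul_exp_neg hx, hre]
  rw [neg_mul, Real.exp_neg, ← div_eq_mul_inv, le_div_iff₀ (Real.exp_pos _), mul_comm]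
  rcases le_total 0 s.im with h | h
  · rw [abs_of_nonneg h]
    exact key θ (by rwa [abs_of_nonneg h0])
  · rw [abs_of_nonpos h]
    simpa using key (-θ) (by rwa [abs_neg, abs_of_nonneg h0])

lemma norm_cos_le_exp (z : ℂ) : ‖cos z‖ ≤ Real.exp |z.im| := by
  have h1 : ‖cexp (z * I)‖ ≤ Real.exp |z.im| := by
    rw [Complex.norm_exp]
    simpa using neg_le_abs z.im
  have h2 : ‖cexp (-z * I)‖ ≤ Real.exp |z.im| := by
    rw [Complex.norm_exp]
    simpa using le_abs_self z.im
  rw [cos, norm_div, Complex.norm_ofNat, div_le_iff₀ two_pos]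
  linarith [norm_add_le (cexp (z * I)) (cexp (-z * I))]

namespace ExpBoundedOnStrip

lemma of_norm_le {f : ℂ → ℂ} {a b d : ℝ} {φ : ℝ → ℝ} (hφ : ContinuousOn φ (Set.Icc a b))
    (h : ∀ s : ℂ, a ≤ s.re → s.re ≤ b → 1 ≤ |s.im| → ‖f s‖ ≤ φ s.re * Real.exp (d * |s.im|)) :
    ExpBoundedOnStrip f a b d := by
  obtain ⟨M, hM⟩ := isCompact_Icc.exists_bound_of_continuousOn hφ
  refine ⟨M, fun s h1 h2 h3 => (h s h1 h2 h3).trans ?_⟩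
  gcongr
  exact (le_abs_self _).trans (hM s.re ⟨h1, h2⟩)

lemma gamma {a b θ : ℝ} (ha : 0 < a) (h0 : 0 ≤ θ) (hθ : θ < Real.pi / 2) :
    ExpBoundedOnStrip Gamma a b (-θ) := by
  refine of_norm_le (φ := fun σ => (1 / Real.cos θ) ^ σ * Real.Gamma σ) ?_
    fun s h1 _ _ => norm_Gamma_le (ha.trans_le h1) h0 hθ
  have hcos : 0 < Real.cos θ := Real.cos_pos_of_mem_Ioo ⟨by linarith, hθ⟩
  intro σ hσ
  refine (ContinuousAt.mul ?_ ?_).continuousWithinAt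
  · exact (Real.continuous_const_rpow (one_div_pos.2 hcos).ne').continuousAt
  · exact (Real.differentiableAt_Gamma fun m h => by
      have := hσ.1; have : (0:ℝ) ≤ m := m.cast_nonneg; linarith).continuousAt

lemma cos_pi_mul_div_two (a b : ℝ) :
    ExpBoundedOnStrip (fun s => cos (Real.pi * s / 2)) a b (Real.pi / 2) := by
  refine of_norm_le (φ := fun _ => 1) continuousOn_const fun s _ _ _ => ?_
  refine (norm_cos_le_exp _).trans (le_of_eq ?_)
  have : ((Real.pi : ℂ) * s / 2).im = Real.pi / 2 * s.im := by
    rw [show (Real.pi : ℂ) * s / 2 = ((Real.pi / 2 : ℝ) : ℂ) * s by push_cast; ring,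
      im_ofReal_mul]
  rw [this, abs_mul, abs_of_pos (by positivity), one_mul]

lemma const_cpow {r : ℝ} (hr : 0 < r) {f : ℂ → ℂ} {φ : ℝ → ℝ} (hφ : Continuous φ)
    (hf : ∀ s, (f s).re = φ s.re) (a b : ℝ) :
    ExpBoundedOnStrip (fun s => (r : ℂ) ^ f s) a b 0 := by
  refine of_norm_le (φ := fun σ => r ^ φ σ)
    ((Real.continuous_const_rpow hr.ne').comp hφ).continuousOn fun s _ _ _ => ?_
  rw [norm_cpow_eq_rpow_re_of_pos hr, hf]
  simp

lemma sub_const (c : ℂ) (a b : ℝ) {ε : ℝ} (hε : 0 < ε) :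
    ExpBoundedOnStrip (fun s => s - c) a b ε := by
  refine of_norm_le (φ := fun σ => (|σ| + ‖c‖ + 1) / ε) (by fun_prop) fun s _ _ h3 => ?_
  have h4 := Real.add_one_le_exp (ε * |s.im|)
  have h5 : ‖s - c‖ ≤ (|s.re| + ‖c‖ + 1) * |s.im| := by
    have := norm_sub_le s c
    have := norm_le_abs_re_add_abs_im s
    nlinarith [abs_nonneg s.re, norm_nonneg c]
  refine h5.trans ?_
  rw [div_mul_eq_mul_div, le_div_iff₀ hε, mul_assoc]
  gcongr
  linarith

lemma comp_one_sub {f : ℂ → ℂ} {a b d : ℝ} (hf : ExpBoundedOnStrip f (1 - b) (1 - a) d) :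
    ExpBoundedOnStrip (fun s => f (1 - s)) a b d := by
  obtain ⟨M, hM⟩ := hf
  refine ⟨M, fun s h1 h2 h3 => ?_⟩
  simpa using hM (1 - s) (by simp; linarith) (by simp; linarith) (by simpa)

lemma comp_add_real {f : ℂ → ℂ} {a b d c : ℝ} (hf : ExpBoundedOnStrip f (a + c) (b + c) d) :
    ExpBoundedOnStrip (fun s => f (s + c)) a b d := by
  obtain ⟨M, hM⟩ := hf
  refine ⟨M, fun s h1 h2 h3 => ?_⟩
  simpa using hM (s + c) (by simpa) (by simpa) (by simpa)

lemma union {f : ℂ → ℂ} {a b c d : ℝ} (h1 : ExpBoundedOnStrip f a c d)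
    (h2 : ExpBoundedOnStrip f c b d) : ExpBoundedOnStrip f a b d := by
  obtain ⟨M, hM⟩ := h1
  obtain ⟨N, hN⟩ := h2
  refine ⟨max M N, fun s ha hb h3 => ?_⟩
  rcases le_total s.re c with h | h
  · refine (hM s ha h h3).trans ?_
    gcongr
    exact le_max_left _ _
  · refine (hN s h hb h3).trans ?_
    gcongr
    exact le_max_right _ _

end ExpBoundedOnStrip

/-! ### Subexponential growth of zeta in vertical strips. -/

/-- The fractional part on `(1, ∞)`, extended by zero. -/
noncomputable def fractTail (t : ℝ) : ℂ := (Set.Ioi (1 : ℝ)).indicator (fun t => ((Int.fract t : ℝ) : ℂ)) t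

lemma norm_fractTail_le (t : ℝ) : ‖fractTail t‖ ≤ 1 := by
  unfold fractTail
  refine (norm_indicator_le_norm_self _ _).trans ?_
  rw [norm_real, Real.norm_of_nonneg (Int.fract_nonneg t)]
  exact (Int.fract_lt_one t).le

lemma measurable_fractTail : Measurable fractTail :=
  Measurable.indicator (f := fun t : ℝ => ((Int.fract t : ℝ) : ℂ)) (by fun_prop) measurableSet_Ioi

lemma differentiableAt_mellin_fractTail {s : ℂ} (hs : s.re < 0) :
    DifferentiableAt ℂ (mellin fractTail) s := by
  refine mellin_differentiableAt_of_isBigO_rpow (a := 0) (b := s.re - 1) ?_ ?_ hs ?_ (by linarith)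
  · refine LocallyIntegrable.locallyIntegrableOn ?_ _
    exact (locallyIntegrable_const (1 : ℝ)).mono measurable_fractTail.aestronglyMeasurable
      (Eventually.of_forall fun t => by simpa using norm_fractTail_le t)
  · simp only [neg_zero, Real.rpow_zero]
    exact Asymptotics.IsBigO.of_bound 1 (Eventually.of_forall fun t => by
      simpa using norm_fractTail_le t)
  · refine Asymptotics.IsBigO.of_bound 1 ?_
    filter_upwards [Ioo_mem_nhdsGT (one_pos : (0:ℝ) < 1)] with t ht
    have : t ∉ Set.Ioi (1 : ℝ) := by simpa using ht.2.le
    simp [fractTail, this]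

lemma mellin_fractTail_eq (s : ℂ) :
    mellin fractTail s = ∫ t in Set.Ioi (1 : ℝ), (t : ℂ) ^ (s - 1) * ((Int.fract t : ℝ) : ℂ) := by
  have : ∀ t : ℝ, (t : ℂ) ^ (s - 1) • fractTail t = (Set.Ioi (1 : ℝ)).indicator
      (fun t : ℝ => (t : ℂ) ^ (s - 1) * ((Int.fract t : ℝ) : ℂ)) t := by
    intro t
    simp only [fractTail, Set.indicator_apply]
    split_ifs <;> simp
  simp only [mellin, this]
  rw [setIntegral_indicator measurableSet_Ioi, Set.inter_eq_self_of_subset_right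
    (Set.Ioi_subset_Ioi zero_le_one)]

lemma norm_cpow_mul_fract_le {s : ℂ} {t : ℝ} (ht : 1 < t) :
    ‖(t : ℂ) ^ (s - 1) * ((Int.fract t : ℝ) : ℂ)‖ ≤ t ^ (s.re - 1) := by
  have h0 : 0 < t := one_pos.trans ht
  rw [norm_mul, norm_cpow_eq_rpow_re_of_pos h0, norm_real,
    Real.norm_of_nonneg (Int.fract_nonneg t), sub_re, one_re]
  exact mul_le_of_le_one_right (by positivity) (Int.fract_lt_one t).le

lemma integrableOn_cpow_mul_fract {s : ℂ} (hs : s.re < 0) :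
    IntegrableOn (fun t : ℝ => (t : ℂ) ^ (s - 1) * ((Int.fract t : ℝ) : ℂ)) (Set.Ioi 1) := by
  refine Integrable.mono' (integrableOn_Ioi_rpow_of_lt (a := s.re - 1) (by linarith) one_pos) ?_ ?_
  · exact Measurable.aestronglyMeasurable (by fun_prop)
  · filter_upwards [self_mem_ae_restrict measurableSet_Ioi] with t ht
    exact norm_cpow_mul_fract_le ht

lemma norm_mellin_fractTail_le {s : ℂ} (hs : s.re < 0) : ‖mellin fractTail s‖ ≤ 1 / (-s.re) := by
  rw [mellin_fractTail_eq]
  refine (norm_integral_le_of_norm_le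
    (integrableOn_Ioi_rpow_of_lt (a := s.re - 1) (by linarith) one_pos) ?_).trans ?_
  · filter_upwards [self_mem_ae_restrict measurableSet_Ioi] with t ht
    exact norm_cpow_mul_fract_le ht
  · rw [integral_Ioi_rpow_of_lt (by linarith) one_pos]
    simp [neg_div, div_neg]

lemma riemannZeta₁_eq_of_ne_one {s : ℂ} (hs : s ≠ 1) :
    riemannZeta₁ s = (s - 1) * riemannZeta s := by
  rw [riemannZeta_eq_inv_sub_mul hs, ← mul_assoc, mul_inv_cancel₀ (sub_ne_zero.2 hs), one_mul]

lemma riemannZeta_eq_mul_integral {s : ℂ} (hs : 1 < s.re) :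
    riemannZeta s = s / (s - 1) - s * mellin fractTail (-s) := by
  have h1 := LSeries_eq_mul_integral_of_nonneg (fun _ => 1) zero_le_one hs
    (by simpa using Asymptotics.isBigO_refl _ _) (fun _ => zero_le_one)
  have h2 : LSeries (fun _ => ((1 : ℝ) : ℂ)) s = riemannZeta s := by
    rw [← LSeries_one_eq_riemannZeta hs]
    congr
  rw [h2] at h1
  rw [h1, mellin_fractTail_eq]
  have h3 : ∀ t ∈ Set.Ioi (1 : ℝ), (∑ k ∈ Finset.Icc 1 ⌊t⌋₊, ((1 : ℝ) : ℂ)) * (t : ℂ) ^ (-(s + 1))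
      = (t : ℂ) ^ (-s) - (t : ℂ) ^ (-s - 1) * ((Int.fract t : ℝ) : ℂ) := by
    intro t ht
    have h0 : 0 < t := one_pos.trans ht
    have h4 : (⌊t⌋₊ : ℂ) = t - ((Int.fract t : ℝ) : ℂ) := by
      have : (⌊t⌋₊ : ℝ) = t - Int.fract t := by
        rw [natCast_floor_eq_intCast_floor h0.le, Int.self_sub_fract]
      exact_mod_cast this
    have h5 : (t : ℂ) ^ (-s) = (t : ℂ) ^ (-s - 1) * t := by
      rw [cpow_sub _ _ (by exact_mod_cast h0.ne'), cpow_one]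
      have : (t : ℂ) ≠ 0 := by exact_mod_cast h0.ne'
      field_simp
    simp only [Finset.sum_const, Nat.card_Icc, ofReal_one, nsmul_eq_mul, mul_one]
    rw [Nat.add_sub_cancel, h4, h5, neg_add']
    ring
  rw [setIntegral_congr_fun measurableSet_Ioi h3, integral_sub, integral_Ioi_cpow_of_lt _ one_pos]
  · have : s - 1 ≠ 0 := by
      intro h
      have := congrArg re h
      simp at this
      linarith
    rw [ofReal_one, one_cpow]
    rw [mul_sub, (by ring : -s + 1 = -(s - 1)), neg_div_neg_eq]
    ring
  · simpa using hs
  · exact integrableOn_Ioi_cpow_of_lt (by simpa using hs) one_pos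
  · exact integrableOn_cpow_mul_fract (by simp; linarith)

/-- Multiplied by `s - 1`, the formula `ζ(s) = s/(s-1) - s ∫ {t} t^(-s-1) dt` has no pole, and the
integral converges for `Re s > 0`, so the identity extends from `Re s > 1`. -/
lemma riemannZeta₁_eq_mellin {s : ℂ} (hs : 0 < s.re) :
    riemannZeta₁ s = s - s * (s - 1) * mellin fractTail (-s) := by
  refine eqOn_halfPlane_of_eq_real (c := 0) (x₀ := 2)
    (g := fun s => s - s * (s - 1) * mellin fractTail (-s))
    differentiable_riemannZeta₁.differentiableOn ?_ two_pos ?_ hs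
  · intro s hs
    have hs' : 0 < s.re := hs
    have h1 : DifferentiableAt ℂ (fun s => mellin fractTail (-s)) s :=
      DifferentiableAt.comp (g := mellin fractTail) (f := fun s : ℂ => -s) s
        (differentiableAt_mellin_fractTail (by simpa)) differentiableAt_id.neg
    exact (differentiableAt_id.sub ((differentiableAt_id.mul
      (differentiableAt_id.sub_const 1)).mul h1)).differentiableWithinAt
  · filter_upwards [lt_mem_nhds (by norm_num : (1:ℝ) < 2)] with x hx
    have hne : (x : ℂ) ≠ 1 := by exact_mod_cast hx.ne'
    have := sub_ne_zero.2 hne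
    rw [riemannZeta₁_eq_of_ne_one hne, riemannZeta_eq_mul_integral (by simpa using hx)]
    field_simp

namespace ExpBoundedOnStrip

lemma riemannZeta_of_half_le (b : ℝ) {ε : ℝ} (hε : 0 < ε) :
    ExpBoundedOnStrip riemannZeta (1 / 2) b ε := by
  have hm : ExpBoundedOnStrip (fun s => mellin fractTail (-s)) (1 / 2) b 0 := by
    refine of_norm_le (φ := fun _ => 2) continuousOn_const fun s h1 _ _ => ?_
    refine (norm_mellin_fractTail_le (by simp; linarith)).trans ?_
    simp only [neg_re, neg_neg, zero_mul, Real.exp_zero, mul_one]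
    rw [div_le_iff₀ (by linarith)]
    linarith
  have hid := sub_const 0 (1 / 2) b (half_pos hε)
  have h := (hid.mono_exp (half_le_self hε.le)).sub
    (((hid.mul (sub_const 1 (1 / 2) b (half_pos hε))).mul hm).mono_exp (e := ε) (by linarith))
  obtain ⟨M, hM⟩ := h
  refine ⟨M, fun s h1 h2 h3 => ?_⟩
  have hne : s ≠ 1 := by rintro rfl; simp at h3; linarith
  -- Away from the real axis the factor `s - 1` has norm at least one, so a bound for `(s-1)ζ(s)` is
  -- a bound for `ζ(s)`.
  have hnorm : 1 ≤ ‖s - 1‖ := h3.trans (by simpa using abs_im_le_norm (s - 1))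
  refine le_trans ?_ (hM s h1 h2 h3)
  simp only [sub_zero]
  rw [← riemannZeta₁_eq_mellin (by linarith), riemannZeta₁_eq_of_ne_one hne, norm_mul]
  exact le_mul_of_one_le_left (norm_nonneg _) hnorm

/-- The Riemann zeta function grows subexponentially in vertical strips. -/
lemma zeta (a b : ℝ) {ε : ℝ} (hε : 0 < ε) : ExpBoundedOnStrip riemannZeta a b ε := by
  refine union (c := 1 / 2) ?_ (riemannZeta_of_half_le b hε)
  -- Left of `1/2` the functional equation brings in `Γ · cos`, of growth rate `π/2 - θ`. Taking `θ`
  -- within `ε/2` of `π/2` leaves the other `ε/2` for zeta on the reflected strip.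
  obtain ⟨θ, hθ0, hθ, hθε⟩ : ∃ θ, 0 ≤ θ ∧ θ < Real.pi / 2 ∧ Real.pi / 2 - θ ≤ ε / 2 :=
    ⟨max 0 (Real.pi / 2 - ε / 2), le_max_left _ _,
      max_lt (by positivity) (by linarith), by linarith [le_max_right 0 (Real.pi / 2 - ε / 2)]⟩
  have hpow : ExpBoundedOnStrip (fun s => ((2 * Real.pi : ℝ) : ℂ) ^ (-s)) (1 - 1 / 2) (1 - a) 0 :=
    const_cpow (by positivity) (φ := fun σ => -σ) continuous_neg (fun s => by simp) _ _
  have h := (((hpow.const_mul 2).mul (gamma (b := 1 - a) (by norm_num : (0:ℝ) < 1 - 1 / 2)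
    hθ0 hθ)).mul (cos_pi_mul_div_two _ _)).mul
    ((riemannZeta_of_half_le (1 - a) (half_pos hε)).mono_left (by norm_num) le_rfl)
  refine ((h.mono_exp (e := ε) (by linarith)).comp_one_sub).congr fun s _ _ h3 => ?_
  have him : (1 - s).im ≠ 0 := by
    intro h; simp at h; simp [h] at h3; linarith
  have := riemannZeta_one_sub (s := 1 - s) (fun n h => him (by simp [h]))
    (fun h => him (by simp [h]))
  rw [sub_sub_cancel] at this
  rw [this]
  push_cast
  ring

end ExpBoundedOnStrip

/-! ### The Dirichlet series of the Piltz divisor function. -/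

lemma piltzDivisor_succ (k n : ℕ) :
    piltzDivisor (k + 1) n = ∑ p ∈ n.divisorsAntidiagonal, piltzDivisor k p.2 := by
  simp only [piltzDivisor]
  rw [← Finset.card_sigma]
  refine Finset.card_nbij' (fun f => ⟨(f 0, ∏ i, Fin.tail f i), Fin.tail f⟩)
    (fun q => Fin.cons q.1.1 q.2) ?_ ?_ ?_ ?_
  · intro f hf
    obtain ⟨hf, hn⟩ := Nat.mem_finMulAntidiag.1 hf
    rw [Fin.prod_univ_succ] at hf
    have h0 : ∏ i, Fin.tail f i ≠ 0 := fun h => hn (by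
      rw [← hf]; exact mul_eq_zero_of_right _ h)
    simp only [Finset.coe_sigma, Set.mem_sigma_iff, Finset.mem_coe,
      Nat.mem_divisorsAntidiagonal, Nat.mem_finMulAntidiag]
    exact ⟨⟨hf, hn⟩, trivial, h0⟩
  · rintro ⟨⟨a, b⟩, f⟩ hq
    simp only [Finset.coe_sigma, Set.mem_sigma_iff, Finset.mem_coe,
      Nat.mem_divisorsAntidiagonal, Nat.mem_finMulAntidiag] at hq ⊢
    obtain ⟨⟨h1, h2⟩, h3, h4⟩ := hq
    refine ⟨?_, h2⟩
    rw [Fin.prod_univ_succ]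
    simp [h3, h1]
  · intro f _
    simp
  · rintro ⟨⟨a, b⟩, f⟩ hq
    simp only [Finset.coe_sigma, Set.mem_sigma_iff, Finset.mem_coe,
      Nat.mem_divisorsAntidiagonal, Nat.mem_finMulAntidiag] at hq
    obtain ⟨-, rfl, -⟩ := hq
    simp

/-- Splitting off one factor of a tuple is Dirichlet convolution with the constant function `1`, so
`d_k` is a `k`-fold convolution power and its Dirichlet series is `ζ^k`. -/
lemma zeta_pow_apply_eq_piltzDivisor (k : ℕ) : ∀ n : ℕ,
    ((ArithmeticFunction.zeta : ArithmeticFunction ℂ) ^ k) n = piltzDivisor k n := by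
  induction k with
  | zero =>
    intro n
    rcases eq_or_ne n 1 with rfl | hn
    · simp [piltzDivisor, Nat.finMulAntidiag_one]
    · simp [piltzDivisor, ArithmeticFunction.one_apply_ne hn, Nat.finMulAntidiag_zero_left hn]
  | succ k ih =>
    intro n
    rw [pow_succ', ArithmeticFunction.mul_apply, piltzDivisor_succ, Nat.cast_sum]
    refine Finset.sum_congr rfl fun p hp => ?_
    have : p.1 ≠ 0 := (Nat.ne_zero_of_mem_divisorsAntidiagonal hp).1
    rw [ih, ArithmeticFunction.natCoe_apply, ArithmeticFunction.zeta_apply_ne this]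
    simp

lemma LSeries_zeta_pow (k : ℕ) {s : ℂ} (hs : 1 < s.re) :
    LSeriesSummable (fun n => ((ArithmeticFunction.zeta : ArithmeticFunction ℂ) ^ k) n) s ∧
      LSeries (fun n => ((ArithmeticFunction.zeta : ArithmeticFunction ℂ) ^ k) n) s =
        riemannZeta s ^ k := by
  have hz : LSeriesSummable (fun n => (ArithmeticFunction.zeta : ArithmeticFunction ℂ) n) s := by
    simpa using ArithmeticFunction.LSeriesSummable_zeta_iff.2 hs
  have hz' : LSeries (fun n => (ArithmeticFunction.zeta : ArithmeticFunction ℂ) n) s =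
      riemannZeta s := by
    simpa using ArithmeticFunction.LSeries_zeta_eq_riemannZeta hs
  induction k with
  | zero =>
    have h1 : (fun n => ((ArithmeticFunction.zeta : ArithmeticFunction ℂ) ^ 0) n) =
        LSeries.delta := by
      ext n
      simp [ArithmeticFunction.one_apply, LSeries.delta]
    rw [h1]
    refine ⟨?_, by simp [LSeries_delta]⟩
    refine summable_of_ne_finset_zero (s := {1}) fun n hn => ?_
    rw [LSeries.term_delta, if_neg (by simpa using hn)]
  | succ k ih =>
    rw [pow_succ, pow_succ, ← ih.2, ← hz']
    exact ⟨ArithmeticFunction.LSeriesSummable_mul ih.1 hz, ArithmeticFunction.LSeries_mul' ih.1 hz⟩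

lemma hasSum_piltzDivisor (k : ℕ) {s : ℂ} (hs : 1 < s.re) :
    HasSum (fun n : ℕ+ => (piltzDivisor k n : ℂ) * (n : ℂ) ^ (-s)) (riemannZeta s ^ k) := by
  have h := LSeries_zeta_pow k hs
  have h1 : HasSum (LSeries.term (fun n => ((ArithmeticFunction.zeta : ArithmeticFunction ℂ) ^ k) n)
      s) (riemannZeta s ^ k) := h.2 ▸ h.1.hasSum
  rw [← Function.Injective.hasSum_iff PNat.coe_injective] at h1
  · refine h1.congr_fun fun n => ?_ |> fun h => h
    rw [Function.comp_apply, LSeries.term_of_ne_zero n.ne_zero, zeta_pow_apply_eq_piltzDivisor,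
      cpow_neg, div_eq_mul_inv]
  · intro n hn
    rcases Nat.eq_zero_or_pos n with rfl | h0
    · simp
    · exact absurd ⟨⟨n, h0⟩, rfl⟩ hn

lemma summable_piltzDivisor_rpow (k : ℕ) {c : ℝ} (hc : 1 < c) :
    Summable (fun n : ℕ+ => (piltzDivisor k n : ℝ) * (n : ℝ) ^ (-c)) := by
  have h := (hasSum_piltzDivisor k (s := c) (by simpa)).summable.norm
  refine h.congr fun n => ?_
  have hn : (0 : ℝ) < (n : ℕ) := by exact_mod_cast n.pos
  rw [norm_mul, Complex.norm_natCast, ← ofReal_natCast, norm_cpow_eq_rpow_re_of_pos hn]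
  simp

/-! ### The Meijer `G`-function as an inverse Mellin transform. -/

/-- The Mellin transform of the inner function of `Ψ`. -/
noncomputable def psiMellin (k : ℕ) (w : ℂ) : ℂ :=
  Gamma w ^ k * cos (Real.pi * w / 2) ^ (k - 1)

lemma meijerGIntegrand_psiParam {k : ℕ} (hk : 1 ≤ k) (z s : ℂ) :
    meijerGIntegrand (k + 1) 0 (Fin.elim0 : Fin 0 → ℂ) (psiParam k) z s =
      Gamma (-s) ^ k * Gamma (1 / 2 - s) / Gamma (1 / 2 + s) ^ (k - 1) * z ^ s := by
  have h1 : ∏ j : Fin (2 * k) with j.val < k + 1, Gamma (psiParam k j - s) =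
      Gamma (-s) ^ k * Gamma (1 / 2 - s) := by
    simp only [psiParam]
    rw [Finset.prod_filter, Fin.prod_univ_eq_prod_range
      (fun j => if j < k + 1 then Gamma ((if j < k then 0 else 1 / 2) - s) else 1) (2 * k),
      ← Finset.prod_range_mul_prod_Ico _ (by omega : k + 1 ≤ 2 * k), Finset.prod_range_succ,
      Finset.prod_congr rfl (g := fun _ => Gamma (-s)), Finset.prod_const, Finset.card_range,
      Finset.prod_eq_one (s := Finset.Ico (k + 1) (2 * k))]
    · simp
    · intro j hj
      rw [if_neg (by have := Finset.mem_Ico.1 hj; omega)]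
    · intro j hj
      have := Finset.mem_range.1 hj
      rw [if_pos (by omega), if_pos this, zero_sub]
  have h2 : ∏ j : Fin (2 * k) with k + 1 ≤ j.val, Gamma (1 - psiParam k j + s) =
      Gamma (1 / 2 + s) ^ (k - 1) := by
    simp only [psiParam]
    rw [Finset.prod_filter, Fin.prod_univ_eq_prod_range
      (fun j => if k + 1 ≤ j then Gamma (1 - (if j < k then 0 else 1 / 2) + s) else 1) (2 * k),
      ← Finset.prod_range_mul_prod_Ico _ (by omega : k + 1 ≤ 2 * k),
      Finset.prod_eq_one (s := Finset.range (k + 1)), one_mul,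
      Finset.prod_congr rfl (g := fun _ => Gamma (1 / 2 + s)), Finset.prod_const, Nat.card_Ico]
    · congr 1
      omega
    · intro j hj
      have := Finset.mem_Ico.1 hj
      rw [if_pos this.1, if_neg (by omega)]
      norm_num
    · intro j hj
      rw [if_neg (by have := Finset.mem_range.1 hj; omega)]
  simp only [meijerGIntegrand, h1, h2, Finset.univ_eq_empty, Finset.filter_empty,
    Finset.prod_empty, mul_one]

lemma inv_Gamma_half_sub {v : ℂ} (hv : 0 < v.re) :
    (Gamma (1 / 2 - v))⁻¹ = Gamma (1 / 2 + v) * cos (Real.pi * v) / Real.pi := by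
  have h1 := Gamma_mul_Gamma_one_sub (1 / 2 - v)
  have hsin : sin (Real.pi * (1 / 2 - v)) = cos (Real.pi * v) := by
    rw [← sin_pi_div_two_sub]
    congr 1
    ring
  have hne : Gamma (1 / 2 + v) ≠ 0 := Gamma_ne_zero_of_re_pos (by simp; linarith)
  rw [hsin, show 1 - (1 / 2 - v) = 1 / 2 + v by ring] at h1
  rw [eq_div_of_mul_eq hne h1, inv_div, div_div_eq_mul_div]

lemma ofReal_pow_cpow {x : ℝ} (hx : 0 < x) (n : ℕ) (r : ℂ) :
    ((x : ℂ) ^ n) ^ r = (x : ℂ) ^ (n * r) := by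
  rw [cpow_nat_mul'] <;> simp [arg_ofReal_of_nonneg hx.le, Real.pi_pos, Real.pi_pos.le]

/-- The constant relating the Mellin–Barnes integrand to `psiMellin`. -/
noncomputable def psiConst (k : ℕ) : ℝ := 2 ^ k * √Real.pi ^ k / Real.pi ^ (k - 1)

/-- Put `v = w/2`. Reflection turns `1/Γ(1/2-v)^(k-1)` into `(Γ(1/2+v) cos(πv)/π)^(k-1)`, which
completes `Γ(v)^k Γ(1/2+v)` to `(Γ(v) Γ(v+1/2))^k`. Duplication then gives `Γ(w)^k`, and its factor
`2^(k(1-w))` meets the `2^(kw)` coming from the argument, leaving only `2^k`. -/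
lemma meijerGIntegrand_eq_psiMellin {k : ℕ} (hk : 1 ≤ k) {Y : ℝ} (hY : 0 < Y) {w : ℂ}
    (hw : 0 < w.re) :
    meijerGIntegrand (k + 1) 0 (Fin.elim0 : Fin 0 → ℂ) (psiParam k)
      (((Y / 2 ^ k) ^ 2 : ℝ) : ℂ) (-(w / 2)) =
      psiConst k * (psiMellin k w * (Y : ℂ) ^ (-w)) := by
  have hv : 0 < (w / 2).re := by simpa using hw
  have hpow : (((Y / 2 ^ k) ^ 2 : ℝ) : ℂ) ^ (-(w / 2)) = (Y : ℂ) ^ (-w) * ((2 : ℂ) ^ w) ^ k := by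
    rw [ofReal_pow, ofReal_pow_cpow (by positivity), show ((2 : ℕ) : ℂ) * -(w / 2) = -w by
      push_cast; ring, ofReal_div, div_cpow_ofReal_nonneg hY.le (by positivity), ofReal_pow,
      ofReal_pow_cpow two_pos, cpow_nat_mul, cpow_neg ((2 : ℝ) : ℂ), inv_pow, div_inv_eq_mul]
    push_cast
    rfl
  have hdup := Gamma_mul_Gamma_add_half (w / 2)
  rw [mul_div_cancel₀ _ (two_ne_zero)] at hdup
  rw [meijerGIntegrand_psiParam hk, neg_neg, sub_neg_eq_add, ← sub_eq_add_neg, div_eq_mul_inv,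
    ← inv_pow, inv_Gamma_half_sub hv, hpow, psiMellin, psiConst]
  have hpi : (Real.pi : ℂ) ≠ 0 := by exact_mod_cast Real.pi_ne_zero
  have h2w : (2 : ℂ) ^ (1 - w) * (2 : ℂ) ^ w = 2 := by
    rw [← cpow_add _ _ two_ne_zero]; simp
  obtain ⟨n, rfl⟩ : ∃ n, k = n + 1 := ⟨k - 1, by omega⟩
  simp only [Nat.add_sub_cancel] at *
  have e : Gamma (w / 2) ^ (n + 1) * Gamma (1 / 2 + w / 2) *
      (Gamma (1 / 2 + w / 2) * cos (Real.pi * (w / 2)) / Real.pi) ^ n =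
      (Gamma (w / 2) * Gamma (w / 2 + 1 / 2)) ^ (n + 1) * cos (Real.pi * w / 2) ^ n /
        Real.pi ^ n := by
    rw [add_comm (1 / 2 : ℂ), ← mul_div_assoc, div_pow, mul_pow, mul_pow]
    ring
  rw [e, hdup]
  push_cast
  calc _ = (2 ^ (1 - w) * 2 ^ w) ^ (n + 1) * ((√Real.pi : ℝ) : ℂ) ^ (n + 1) / Real.pi ^ n *
        (Gamma w ^ (n + 1) * cos (Real.pi * w / 2) ^ n * (Y : ℂ) ^ (-w)) := by ring
    _ = _ := by rw [h2w]

/-- There are `k` Gamma factors against `k - 1` cosines, so `θ = π/2 - π/(4k)` still leaves a net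
decay rate of `π/4`. -/
lemma exists_decay_angle (k : ℕ) (hk : 1 ≤ k) : ∃ θ, 0 ≤ θ ∧ θ < Real.pi / 2 ∧
    k * (-θ) + ((k - 1 : ℕ) : ℝ) * (Real.pi / 2) = -(Real.pi / 4) := by
  have hk' : (1 : ℝ) ≤ k := by exact_mod_cast hk
  have hpi := Real.pi_pos
  refine ⟨Real.pi / 2 - Real.pi / (4 * k), ?_, by simp; positivity, ?_⟩
  · rw [sub_nonneg]
    exact div_le_div_of_nonneg_left hpi.le two_pos (by linarith)
  · rw [Nat.cast_sub hk]
    push_cast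
    field_simp
    ring

lemma expBoundedOnStrip_psiMellin {k : ℕ} (hk : 1 ≤ k) {a : ℝ} (ha : 0 < a) (b : ℝ) :
    ExpBoundedOnStrip (psiMellin k) a b (-(Real.pi / 4)) := by
  obtain ⟨θ, h0, h1, h2⟩ := exists_decay_angle k hk
  rw [← h2]
  exact ((ExpBoundedOnStrip.gamma ha h0 h1).pow k).mul
    ((ExpBoundedOnStrip.cos_pi_mul_div_two a b).pow (k - 1))

lemma differentiableAt_psiMellin (k : ℕ) {w : ℂ} (hw : 0 < w.re) :
    DifferentiableAt ℂ (psiMellin k) w := by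
  have h1 : DifferentiableAt ℂ Gamma w := differentiableAt_Gamma _ fun n h => by
    have := congrArg re h
    simp at this
    have h0 : (0 : ℝ) ≤ n := n.cast_nonneg
    linarith
  unfold psiMellin
  exact (h1.pow k).mul (by fun_prop)

lemma expBoundedOnStrip_psiMellin_mul_cpow {k : ℕ} (hk : 1 ≤ k) {a : ℝ} (ha : 0 < a) (b : ℝ)
    {Y : ℝ} (hY : 0 < Y) : ExpBoundedOnStrip (fun w => psiMellin k w * (Y : ℂ) ^ (-w)) a b
      (-(Real.pi / 4)) := by
  simpa using (expBoundedOnStrip_psiMellin hk ha b).mul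
    (ExpBoundedOnStrip.const_cpow hY (f := fun w => -w) continuous_neg (fun w => by simp) a b)

lemma differentiableAt_psiMellin_mul_cpow (k : ℕ) {Y : ℝ} (hY : 0 < Y) {w : ℂ} (hw : 0 < w.re) :
    DifferentiableAt ℂ (fun w => psiMellin k w * (Y : ℂ) ^ (-w)) w :=
  (differentiableAt_psiMellin k hw).mul
    (differentiableAt_id.neg.const_cpow (Or.inl (by exact_mod_cast hY.ne')))

/-- The inverse Mellin transform of `psiMellin` along `Re w = c`. -/
noncomputable def psiKernel (k : ℕ) (c Y : ℝ) : ℂ :=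
  1 / (2 * Real.pi) * ∫ t : ℝ, psiMellin k (c + t * I) * (Y : ℂ) ^ (-((c : ℂ) + t * I))

lemma integrable_psiMellin_mul_cpow {k : ℕ} (hk : 1 ≤ k) {c Y : ℝ} (hc : 0 < c) (hY : 0 < Y) :
    Integrable fun t : ℝ => psiMellin k (c + t * I) * (Y : ℂ) ^ (-((c : ℂ) + t * I)) :=
  (expBoundedOnStrip_psiMellin_mul_cpow hk hc c hY).integrable_line (by linarith [Real.pi_pos])
    le_rfl le_rfl (continuous_iff_continuousAt.2 fun t =>
      ContinuousAt.comp (g := fun w => psiMellin k w * (Y : ℂ) ^ (-w))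
      (f := fun t : ℝ => (c : ℂ) + t * I)
      (differentiableAt_psiMellin_mul_cpow k hY (by simpa)).continuousAt (by fun_prop))

/-- The integrand has no pole in `Re w > 0`, so the abscissa is free there. This makes `Ψ`
independent of `C`, and lets `c` be taken large enough for the sums over `j` and `n` to converge
absolutely. -/
lemma psiKernel_eq {k : ℕ} (hk : 1 ≤ k) {c c' Y : ℝ} (hc : 0 < c) (hc' : 0 < c') (hY : 0 < Y) :
    psiKernel k c Y = psiKernel k c' Y := by
  wlog h : c ≤ c' generalizing c c'
  · exact (this hc' hc (le_of_not_ge h)).symm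
  unfold psiKernel
  rw [← (expBoundedOnStrip_psiMellin_mul_cpow hk hc c' hY).integral_eq h
    (fun w hw => (differentiableAt_psiMellin_mul_cpow k hY
      (hc.trans_le hw.1)).differentiableWithinAt) (by linarith [Real.pi_pos])]

lemma meijerGIntegrand_line {k : ℕ} (hk : 1 ≤ k) {C Y : ℝ} (hC : C < 0) (hY : 0 < Y) (t : ℝ) :
    meijerGIntegrand (k + 1) 0 (Fin.elim0 : Fin 0 → ℂ) (psiParam k)
      (((Y / 2 ^ k) ^ 2 : ℝ) : ℂ) (C + t * I) =
      psiConst k * (psiMellin k (((-2 * C : ℝ) : ℂ) + ((-2 * t : ℝ) : ℂ) * I) *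
        (Y : ℂ) ^ (-(((-2 * C : ℝ) : ℂ) + ((-2 * t : ℝ) : ℂ) * I))) := by
  rw [← meijerGIntegrand_eq_psiMellin hk hY (by simp; linarith)]
  congr 1
  push_cast
  ring

lemma integrable_meijerGIntegrand {k : ℕ} (hk : 1 ≤ k) {C z : ℝ} (hC : C < 0) (hz : 0 < z) :
    Integrable (fun t : ℝ => meijerGIntegrand (k + 1) 0 (Fin.elim0 : Fin 0 → ℂ) (psiParam k) z
      (C + t * I)) := by
  have hY : 0 < √z * 2 ^ k := by positivity
  have hz' : z = (√z * 2 ^ k / 2 ^ k) ^ 2 := by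
    rw [mul_div_cancel_right₀ _ (by positivity), Real.sq_sqrt hz.le]
  rw [hz']
  simp_rw [meijerGIntegrand_line hk hC hY]
  exact ((integrable_psiMellin_mul_cpow hk (by linarith : 0 < -2 * C) hY).comp_mul_left'
    (by norm_num : (-2 : ℝ) ≠ 0)).const_mul _

/-- The substitution `w = -2s` carries `Re s = C` to `Re w = -2C`; its Jacobian is the factor `1/2`.
-/
lemma meijerG_eq_psiKernel {k : ℕ} (hk : 1 ≤ k) {C Y : ℝ} (hC : C < 0) (hY : 0 < Y) :
    meijerG (k + 1) 0 (Fin.elim0 : Fin 0 → ℂ) (psiParam k) C (((Y / 2 ^ k) ^ 2 : ℝ) : ℂ) =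
      psiConst k / 2 * psiKernel k (-2 * C) Y := by
  have h := Measure.integral_comp_mul_left (fun t : ℝ => psiMellin k (((-2 * C : ℝ) : ℂ) + t * I) *
    (Y : ℂ) ^ (-(((-2 * C : ℝ) : ℂ) + t * I))) (-2)
  unfold meijerG psiKernel
  simp_rw [meijerGIntegrand_line hk hC hY]
  rw [integral_mul_const, integral_const_mul, h]
  have h2 : |(-2 : ℝ)⁻¹| = 1 / 2 := by rw [abs_inv]; norm_num
  rw [h2, real_smul]
  have hpi : (Real.pi : ℂ) ≠ 0 := by exact_mod_cast Real.pi_ne_zero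
  push_cast
  field_simp

lemma psi_factor_mul_psiConst {k : ℕ} (hk : 1 ≤ k) :
    Real.pi ^ ((k : ℝ) / 2 - 1) / 2 ^ (k - 1) * (psiConst k / 2) = 1 := by
  obtain ⟨n, rfl⟩ : ∃ n, k = n + 1 := ⟨k - 1, by omega⟩
  have hpi := Real.pi_pos
  have h1 : Real.pi ^ (((n + 1 : ℕ) : ℝ) / 2 - 1) = √Real.pi ^ (n + 1) / Real.pi := by
    rw [Real.rpow_sub_one hpi.ne', Real.sqrt_eq_rpow, ← Real.rpow_mul_natCast hpi.le]
    congr 2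
    ring
  have h2 : √Real.pi ^ (n + 1) * √Real.pi ^ (n + 1) = Real.pi ^ (n + 1) := by
    rw [← mul_pow, Real.mul_self_sqrt hpi.le]
  rw [h1, psiConst, Nat.add_sub_cancel]
  field_simp
  rw [sq, h2]
  ring

lemma psi_factor_mul_psiTerm {k : ℕ} (hk : 1 ≤ k) {C ρ x c : ℝ} (hC : C < 0) (hρ : 0 < ρ)
    (hx : 0 < x) (hc : 0 < c) (j : ℕ+) :
    ((Real.pi ^ ((k : ℝ) / 2 - 1) / 2 ^ (k - 1) : ℝ) : ℂ) * psiTerm k C ρ x j =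
      piltzDivisor k j * psiKernel k c (ρ * j * x) := by
  have hj : (0 : ℝ) < (j : ℕ) := by exact_mod_cast j.pos
  have hY : 0 < ρ * j * x := by positivity
  have harg : ρ ^ 2 * ((j : ℕ) : ℝ) ^ 2 * x ^ 2 / 2 ^ (2 * k) = (ρ * j * x / 2 ^ k) ^ 2 := by
    rw [div_pow, mul_pow, mul_pow, ← pow_mul, mul_comm k 2]
  have hone : ((Real.pi ^ ((k : ℝ) / 2 - 1) / 2 ^ (k - 1) : ℝ) : ℂ) * (psiConst k / 2) = 1 := by
    exact_mod_cast congrArg ((↑) : ℝ → ℂ) (psi_factor_mul_psiConst hk)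
  rw [psiTerm, harg, meijerG_eq_psiKernel hk hC hY, psiKernel_eq hk (by linarith) hc hY]
  linear_combination (piltzDivisor k j * psiKernel k c (ρ * j * x)) * hone

lemma norm_psiKernel_le {k : ℕ} {c Y : ℝ} (hY : 0 < Y) :
    ‖psiKernel k c Y‖ ≤ 1 / (2 * Real.pi) * ((∫ t : ℝ, ‖psiMellin k (c + t * I)‖) * Y ^ (-c)) := by
  have h1 : ‖(1 / (2 * Real.pi) : ℂ)‖ = 1 / (2 * Real.pi) := by
    simp [abs_of_pos Real.pi_pos]
  rw [psiKernel, norm_mul, h1, ← integral_mul_const]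
  refine mul_le_mul_of_nonneg_left ((norm_integral_le_integral_norm _).trans (le_of_eq ?_))
    (by positivity)
  congr 1 with t
  rw [norm_mul, norm_cpow_eq_rpow_re_of_pos hY]
  simp

lemma summable_piltzDivisor_mul_psiKernel (k : ℕ) {c ρ x : ℝ} (hc : 1 < c) (hρ : 0 < ρ)
    (hx : 0 < x) : Summable fun j : ℕ+ => (piltzDivisor k j : ℂ) * psiKernel k c (ρ * j * x) := by
  refine Summable.of_norm_bounded (((summable_piltzDivisor_rpow k hc).mul_left
    (1 / (2 * Real.pi) * ((∫ t : ℝ, ‖psiMellin k (c + t * I)‖) * (ρ ^ (-c) * x ^ (-c))))))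
    fun j => ?_
  have hj : (0 : ℝ) < (j : ℕ) := by exact_mod_cast j.pos
  rw [norm_mul, Complex.norm_natCast]
  refine (mul_le_mul_of_nonneg_left (norm_psiKernel_le (by positivity))
    (Nat.cast_nonneg _)).trans (le_of_eq ?_)
  rw [Real.mul_rpow (by positivity) hx.le, Real.mul_rpow hρ.le hj.le]
  ring

lemma summable_psiTerm {k : ℕ} (hk : 1 ≤ k) {C ρ x : ℝ} (hC : C < 0) (hρ : 0 < ρ) (hx : 0 < x) :
    Summable (fun j : ℕ+ => psiTerm k C ρ x j) := by
  have h := summable_piltzDivisor_mul_psiKernel k (c := 2) one_lt_two hρ hx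
  simp_rw [← psi_factor_mul_psiTerm hk hC hρ hx (two_pos)] at h
  refine (summable_mul_left_iff ?_).1 h
  rw [Ne, ofReal_eq_zero]
  have := Real.pi_pos
  positivity

lemma Psi_eq_tsum {k : ℕ} (hk : 1 ≤ k) {C ρ x c : ℝ} (hC : C < 0) (hρ : 0 < ρ) (hx : 0 < x)
    (hc : 0 < c) :
    Psi k C ρ x = ∑' j : ℕ+, (piltzDivisor k j : ℂ) * psiKernel k c (ρ * j * x) := by
  rw [Psi, ← tsum_mul_left]
  exact tsum_congr fun j => psi_factor_mul_psiTerm hk hC hρ hx hc j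

/-! ### The double series over `n` and `j` under the integral sign. -/

lemma hasSum_prod_mul {ι κ : Type*} {f : ι → ℂ} {g : κ → ℂ} {a b : ℂ} (hf : HasSum f a)
    (hg : HasSum g b) : HasSum (fun p : ι × κ => f p.1 * g p.2) (a * b) :=
  hf.mul hg (summable_mul_of_summable_norm hf.summable.norm hg.summable.norm)

lemma summable_prod_mul {ι κ : Type*} {f : ι → ℝ} {g : κ → ℝ} (hf : Summable f)
    (hg : Summable g) (hf0 : ∀ i, 0 ≤ f i) (hg0 : ∀ j, 0 ≤ g j) :
    Summable (fun p : ι × κ => f p.1 * g p.2) :=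
  hf.mul_of_nonneg hg hf0 hg0

/-- The generalized Eisenstein series as an inverse Mellin transform. -/
lemma hasSum_eisenstein {k : ℕ} (hk : 1 ≤ k) {C ρ c : ℝ} (hC : C < 0) (hρ : 0 < ρ) (e : ℕ)
    (hc : e + 1 < c) :
    HasSum (fun n : ℕ+ => (piltzDivisor k n : ℂ) * (n : ℂ) ^ e * Psi k C ρ n)
      (1 / (2 * Real.pi) * ∫ t : ℝ, psiMellin k (c + t * I) * (ρ : ℂ) ^ (-((c : ℂ) + t * I)) *
        riemannZeta (c + t * I - e) ^ k * riemannZeta (c + t * I) ^ k) := by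
  have he : (0 : ℝ) ≤ e := e.cast_nonneg
  have hc0 : 0 < c := by linarith
  set F : ℕ+ × ℕ+ → ℝ → ℂ := fun p t => (piltzDivisor k p.1 : ℂ) * (p.1 : ℂ) ^ e *
    piltzDivisor k p.2 * (psiMellin k (c + t * I) *
      ((ρ * (p.2 : ℕ) * (p.1 : ℕ) : ℝ) : ℂ) ^ (-((c : ℂ) + t * I))) with hF
  have hpos : ∀ n : ℕ+, (0 : ℝ) < (n : ℕ) := fun n => by exact_mod_cast n.pos
  have hY : ∀ p : ℕ+ × ℕ+, 0 < ρ * (p.2 : ℕ) * (p.1 : ℕ) := fun p =>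
    mul_pos (mul_pos hρ (hpos _)) (hpos _)
  have hint : ∀ p, Integrable (F p) := fun p =>
    (integrable_psiMellin_mul_cpow hk hc0 (hY p)).const_mul _
  have hsplit : ∀ p t, F p t = psiMellin k (c + t * I) * (ρ : ℂ) ^ (-((c : ℂ) + t * I)) *
      (((piltzDivisor k p.1 : ℂ) * (p.1 : ℂ) ^ (-((c : ℂ) + t * I - e))) *
        ((piltzDivisor k p.2 : ℂ) * (p.2 : ℂ) ^ (-((c : ℂ) + t * I)))) := by
    intro p t
    have h1 : ((p.1 : ℕ) : ℂ) ^ (-((c : ℂ) + t * I - e)) =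
        ((p.1 : ℕ) : ℂ) ^ e * ((p.1 : ℕ) : ℂ) ^ (-((c : ℂ) + t * I)) := by
      rw [neg_sub, sub_eq_add_neg, cpow_add _ _ (by exact_mod_cast p.1.ne_zero), cpow_natCast]
    simp only [hF]
    rw [h1, ofReal_mul, mul_cpow_ofReal_nonneg (mul_pos hρ (hpos _)).le (hpos _).le, ofReal_mul,
      mul_cpow_ofReal_nonneg hρ.le (hpos _).le, ofReal_natCast, ofReal_natCast]
    ring
  have hnorm : ∀ p, ∫ t, ‖F p t‖ = (∫ t : ℝ, ‖psiMellin k (c + t * I)‖) * ρ ^ (-c) *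
      (((piltzDivisor k p.1 : ℝ) * ((p.1 : ℕ) : ℝ) ^ (-(c - e))) *
        ((piltzDivisor k p.2 : ℝ) * ((p.2 : ℕ) : ℝ) ^ (-c))) := by
    intro p
    rw [mul_assoc, ← integral_mul_const]
    congr 1 with t
    rw [hsplit]
    simp only [norm_mul, Complex.norm_natCast]
    rw [← ofReal_natCast (p.1 : ℕ), ← ofReal_natCast (p.2 : ℕ),
      norm_cpow_eq_rpow_re_of_pos hρ, norm_cpow_eq_rpow_re_of_pos (hpos _),
      norm_cpow_eq_rpow_re_of_pos (hpos _)]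
    simp
    ring
  -- The integrals of the norms factor into a constant times `d_k(n) n^(-(c-e))` times `d_k(j)
  -- j^(-c)`. Both series converge since `c - e > 1`, and this justifies the interchange.
  have hsum : Summable fun p => ∫ t, ‖F p t‖ := by
    have h := summable_prod_mul (summable_piltzDivisor_rpow k (by linarith : 1 < c - e))
      (summable_piltzDivisor_rpow k (by linarith : 1 < c)) (fun n => by positivity)
      (fun n => by positivity)
    exact (h.mul_left ((∫ t : ℝ, ‖psiMellin k (c + t * I)‖) * ρ ^ (-c))).congr
      fun p => (hnorm p).symm
  have hpt : ∀ t : ℝ, ∑' p, F p t = psiMellin k (c + t * I) * (ρ : ℂ) ^ (-((c : ℂ) + t * I)) *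
        riemannZeta (c + t * I - e) ^ k * riemannZeta (c + t * I) ^ k := by
    intro t
    have h1 := hasSum_piltzDivisor k (s := (c : ℂ) + t * I - e) (by simp; linarith)
    have h2 := hasSum_piltzDivisor k (s := (c : ℂ) + t * I) (by simp; linarith)
    have h3 := hasSum_prod_mul h1 h2
    have h4 := h3.mul_left (psiMellin k (c + t * I) * (ρ : ℂ) ^ (-((c : ℂ) + t * I)))
    simp_rw [← hsplit] at h4
    rw [h4.tsum_eq]
    ring
  have hmain := (hasSum_integral_of_summable_integral_norm hint hsum).mul_left
    (1 / (2 * Real.pi) : ℂ)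
  simp_rw [hpt] at hmain
  -- Summing the double family over `j` first reassembles `Ψ` at `n`.
  refine hmain.prod_fiberwise fun n => ?_
  have hval : ∀ j : ℕ+, (1 / (2 * Real.pi) : ℂ) * ∫ t, F (n, j) t =
      (piltzDivisor k n : ℂ) * (n : ℂ) ^ e *
        ((piltzDivisor k j : ℂ) * psiKernel k c (ρ * j * n)) := by
    intro j
    simp only [hF, integral_const_mul, psiKernel]
    ring
  simp_rw [hval]
  rw [Psi_eq_tsum hk hC hρ (hpos n) hc0]
  exact (summable_piltzDivisor_mul_psiKernel k (by linarith) hρ (hpos n)).hasSum.mul_left _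

/-! ### The symmetry `w ↦ 2m - w`. -/

/-- The Mellin transform of the generalized Eisenstein series. -/
noncomputable def eisensteinMellin (k m : ℕ) (α : ℝ) (w : ℂ) : ℂ :=
  psiMellin k w * riemannZeta w ^ k * riemannZeta (w + 1 - 2 * m) ^ k *
    (2 : ℂ) ^ (-(k : ℂ) * w) * (α : ℂ) ^ (-(k : ℂ) * (w - m))

/-- The form of `eisensteinMellin` whose symmetry about `Re w = m` is visible. -/
noncomputable def eisensteinSymm (k m : ℕ) (α : ℝ) (w : ℂ) : ℂ :=
  riemannZeta (1 - w) ^ k * riemannZeta (w + 1 - 2 * m) ^ k * (Real.pi : ℂ) ^ (k * w) / 2 ^ k *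
    (α : ℂ) ^ (-(k : ℂ) * (w - m)) / cos (Real.pi * w / 2)

lemma neg_natCast_mul_cpow (x : ℂ) (k : ℕ) (w : ℂ) : x ^ (-(k : ℂ) * w) = (x ^ (-w)) ^ k := by
  rw [← cpow_nat_mul, neg_mul, mul_neg]

/-- The `k`-th power of `ζ(1-w) = 2 (2π)^(-w) Γ(w) cos(πw/2) ζ(w)` absorbs `Γ(w)^k ζ(w)^k` and asks
for `k` cosines. Only `k - 1` are present, so one is left in the denominator. -/
lemma eisensteinMellin_eq_eisensteinSymm {k : ℕ} (hk : 1 ≤ k) (m : ℕ) (α : ℝ) {w : ℂ}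
    (h0 : ∀ n : ℕ, w ≠ -n) (h1 : w ≠ 1) (hcos : cos (Real.pi * w / 2) ≠ 0) :
    eisensteinMellin k m α w = eisensteinSymm k m α w := by
  obtain ⟨n, rfl⟩ : ∃ n, k = n + 1 := ⟨k - 1, by omega⟩
  have h2pi : (2 * Real.pi : ℂ) ^ (-w) * (Real.pi : ℂ) ^ w = (2 : ℂ) ^ (-w) := by
    have h := mul_cpow_ofReal_nonneg (zero_le_two) Real.pi_pos.le (-w)
    rw [ofReal_ofNat] at h
    have hpi : (Real.pi : ℂ) ≠ 0 := by exact_mod_cast Real.pi_ne_zero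
    rw [h, mul_assoc, ← cpow_add _ _ hpi]
    simp
  rw [eisensteinMellin, eisensteinSymm, riemannZeta_one_sub h0 h1, cpow_nat_mul (Real.pi : ℂ),
    neg_natCast_mul_cpow 2, ← h2pi, psiMellin, Nat.add_sub_cancel]
  field_simp
  ring

lemma cos_pi_mul_nat_sub (m : ℕ) (w : ℂ) :
    cos (Real.pi * (2 * m - w) / 2) = (-1) ^ m * cos (Real.pi * w / 2) := by
  rw [show (Real.pi * (2 * m - w) / 2 : ℂ) = m * Real.pi - Real.pi * w / 2 by ring,
    cos_antiperiodic.nat_mul_sub_eq, cos_neg]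

/-- The reflection swaps the two zeta factors and multiplies the cosine by `(-1)^m`; `αβ = π²` is
what trades the powers of `π` and `α` for those of `π` and `β`. -/
lemma eisensteinSymm_reflect (k m : ℕ) {α β : ℝ} (hα : 0 < α) (hβ : 0 < β)
    (hαβ : α * β = Real.pi ^ 2) (w : ℂ) :
    eisensteinSymm k m α (2 * m - w) = (-1) ^ m * eisensteinSymm k m β w := by
  have hpi : (Real.pi : ℂ) ≠ 0 := by exact_mod_cast Real.pi_ne_zero
  have hβ' : (β : ℂ) ≠ 0 := by exact_mod_cast hβ.ne'
  have hpow : (Real.pi : ℂ) ^ ((k : ℂ) * (2 * m - w)) * (α : ℂ) ^ (-(k : ℂ) * (2 * m - w - m)) =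
      (Real.pi : ℂ) ^ (k * w) * (β : ℂ) ^ (-(k : ℂ) * (w - m)) := by
    have h1 : (α : ℂ) ^ (-(k : ℂ) * (2 * m - w - m)) * (β : ℂ) ^ (-(k : ℂ) * (2 * m - w - m)) =
        (Real.pi : ℂ) ^ ((2 : ℕ) * (-(k : ℂ) * (2 * m - w - m))) := by
      rw [← mul_cpow_ofReal_nonneg hα.le hβ.le, ← ofReal_mul, hαβ, ofReal_pow,
        ofReal_pow_cpow Real.pi_pos]
    have h2 : (β : ℂ) ^ (-(k : ℂ) * (2 * m - w - m)) * (β : ℂ) ^ (-(k : ℂ) * (w - m)) = 1 := by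
      rw [← cpow_add _ _ hβ', ← cpow_zero (β : ℂ)]
      congr 1
      ring
    have h3 : (Real.pi : ℂ) ^ ((k : ℂ) * (2 * m - w)) *
        (Real.pi : ℂ) ^ ((2 : ℕ) * (-(k : ℂ) * (2 * m - w - m))) = (Real.pi : ℂ) ^ (k * w) := by
      rw [← cpow_add _ _ hpi]
      congr 1
      push_cast
      ring
    rw [← h3, ← h1]
    linear_combination (-((Real.pi : ℂ) ^ ((k : ℂ) * (2 * m - w)) *
      (α : ℂ) ^ (-(k : ℂ) * (2 * m - w - m)))) * h2
  have hsign : ((-1 : ℂ) ^ m)⁻¹ = (-1) ^ m := by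
    rw [← inv_pow]; norm_num
  have e1 : (1 : ℂ) - (2 * m - w) = w + 1 - 2 * m := by ring
  have e2 : (2 * m - w + 1 - 2 * m : ℂ) = 1 - w := by ring
  simp only [eisensteinSymm]
  rw [cos_pi_mul_nat_sub, e1, e2, div_eq_mul_inv _ ((-1) ^ m * _), mul_inv, hsign]
  calc _ = riemannZeta (w + 1 - 2 * m) ^ k * riemannZeta (1 - w) ^ k *
        ((Real.pi : ℂ) ^ ((k : ℂ) * (2 * m - w)) * (α : ℂ) ^ (-(k : ℂ) * (2 * m - w - m))) / 2 ^ k *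
        ((-1) ^ m * (cos (Real.pi * w / 2))⁻¹) := by ring
    _ = _ := by rw [hpow]; ring

/-- The combination of Mellin transforms that is odd about `Re w = m`. -/
noncomputable def eisensteinOdd (k m : ℕ) (α β : ℝ) (w : ℂ) : ℂ :=
  eisensteinMellin k m α w - (-1) ^ m * eisensteinMellin k m β w

/-- `eisensteinOdd` freed from its pole at `w = 2m`. -/
noncomputable def eisensteinNumerator (k m : ℕ) (α β : ℝ) (w : ℂ) : ℂ :=
  psiMellin k w * riemannZeta w ^ k * riemannZeta₁ (w + 1 - 2 * m) ^ k *
    (2 : ℂ) ^ (-(k : ℂ) * w) *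
    ((α : ℂ) ^ (-(k : ℂ) * (w - m)) - (-1) ^ m * (β : ℂ) ^ (-(k : ℂ) * (w - m)))

lemma eisensteinOdd_eq_div (k m : ℕ) (α β : ℝ) {w : ℂ} (hw : w ≠ 2 * m) :
    eisensteinOdd k m α β w = eisensteinNumerator k m α β w / (w - 2 * m) ^ k := by
  have h1 : w + 1 - 2 * m ≠ 1 := fun h => hw (by linear_combination h)
  have h2 : (w - 2 * m) ^ k ≠ 0 := pow_ne_zero _ (sub_ne_zero.2 hw)
  rw [eisensteinNumerator, riemannZeta₁_eq_of_ne_one h1, eq_div_iff h2, eisensteinOdd,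
    eisensteinMellin, eisensteinMellin, mul_pow]
  ring

/-- The excluded points are those where the functional equation, applied at `w` and at `2m - w`, is
unavailable or where the cosine in the denominator vanishes. -/
lemma eisensteinOdd_reflect {k m : ℕ} (hk : 1 ≤ k) {α β : ℝ} (hα : 0 < α) (hβ : 0 < β)
    (hαβ : α * β = Real.pi ^ 2) {w : ℂ} (h0 : ∀ n : ℕ, w ≠ -n) (h1 : w ≠ 1)
    (h0' : ∀ n : ℕ, 2 * m - w ≠ -n) (h1' : 2 * m - w ≠ 1) (hcos : cos (Real.pi * w / 2) ≠ 0) :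
    eisensteinOdd k m α β (2 * m - w) = -eisensteinOdd k m α β w := by
  have hcos' : cos (Real.pi * (2 * m - w) / 2) ≠ 0 := by
    rw [cos_pi_mul_nat_sub]
    exact mul_ne_zero (pow_ne_zero _ (by norm_num)) hcos
  have hsq : ((-1 : ℂ) ^ m) * (-1) ^ m = 1 := by rw [← mul_pow]; norm_num
  simp only [eisensteinOdd]
  rw [eisensteinMellin_eq_eisensteinSymm hk m α h0' h1' hcos',
    eisensteinMellin_eq_eisensteinSymm hk m β h0' h1' hcos',
    eisensteinMellin_eq_eisensteinSymm hk m α h0 h1 hcos,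
    eisensteinMellin_eq_eisensteinSymm hk m β h0 h1 hcos,
    eisensteinSymm_reflect k m hα hβ hαβ,
    eisensteinSymm_reflect k m hβ hα (by rwa [mul_comm])]
  linear_combination (-eisensteinSymm k m α w) * hsq

/-- The power `s^k` comes from `Γ(s+1) = sΓ(s)`. Hence the `(k-1)`-th Taylor coefficient of the
kernel at `0` is the residue of `eisensteinOdd` there. -/
lemma eisensteinKernel_eq (k m : ℕ) (α β : ℝ) {s : ℂ} (hs : s ≠ 0) :
    eisensteinKernel k m α β s = s ^ k * eisensteinOdd k m α β s := by
  rw [eisensteinKernel, Gamma_add_one s hs, eisensteinOdd, eisensteinMellin, eisensteinMellin,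
    psiMellin, mul_pow, show (1 - 2 * m + s : ℂ) = s + 1 - 2 * m by ring]
  ring

lemma analyticAt_eisensteinKernel (k : ℕ) {m : ℕ} (hm : 1 ≤ m) {α β : ℝ} (hα : 0 < α)
    (hβ : 0 < β) : AnalyticAt ℂ (eisensteinKernel k m α β) 0 := by
  have hα' : (α : ℂ) ≠ 0 := by exact_mod_cast hα.ne'
  have hβ' : (β : ℂ) ≠ 0 := by exact_mod_cast hβ.ne'
  have hm0 : (m : ℂ) ≠ 0 := by exact_mod_cast (by omega : m ≠ 0)
  have hm' : ∀ᶠ s : ℂ in 𝓝 0, (1 - 2 * m + s : ℂ) ≠ 1 := by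
    refine ContinuousAt.eventually_ne (by fun_prop) fun h => hm0 ?_
    linear_combination (-1 / 2 : ℂ) * h
  have h1 : ∀ᶠ s : ℂ in 𝓝 0, s ≠ 1 := eventually_ne_nhds zero_ne_one
  have h2 : ∀ᶠ s : ℂ in 𝓝 0, -1 < s.re :=
    (isOpen_lt continuous_const continuous_re).mem_nhds (by simp)
  rw [Complex.analyticAt_iff_eventually_differentiableAt]
  filter_upwards [hm', h1, h2] with s hs1 hs2 hs3
  have hz1 : DifferentiableAt ℂ (fun s : ℂ => riemannZeta (1 - 2 * m + s)) s :=
    DifferentiableAt.comp (g := riemannZeta) s (differentiableAt_riemannZeta hs1) (by fun_prop)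
  have hz2 : DifferentiableAt ℂ riemannZeta s := differentiableAt_riemannZeta hs2
  have hg : DifferentiableAt ℂ (fun s : ℂ => Gamma (s + 1)) s := by
    refine DifferentiableAt.comp (g := Gamma) s (differentiableAt_Gamma _ fun n h => ?_)
      (by fun_prop)
    have := congrArg re h
    simp at this
    have h0 : (0 : ℝ) ≤ n := n.cast_nonneg
    linarith
  have h2p : DifferentiableAt ℂ (fun s : ℂ => (2 : ℂ) ^ (-(k : ℂ) * s)) s :=
    DifferentiableAt.const_cpow (by fun_prop) (Or.inl two_ne_zero)
  have hap : DifferentiableAt ℂ (fun s : ℂ => (α : ℂ) ^ (-(k : ℂ) * (s - m))) s :=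
    DifferentiableAt.const_cpow (by fun_prop) (Or.inl hα')
  have hbp : DifferentiableAt ℂ (fun s : ℂ => (β : ℂ) ^ (-(k : ℂ) * (s - m))) s :=
    DifferentiableAt.const_cpow (by fun_prop) (Or.inl hβ')
  unfold eisensteinKernel
  fun_prop

/-! ### Holomorphy and decay of the combined integrand. -/

lemma differentiableAt_eisensteinNumerator (k m : ℕ) {α β : ℝ} (hα : 0 < α) (hβ : 0 < β) {w : ℂ}
    (hw : 1 < w.re) : DifferentiableAt ℂ (eisensteinNumerator k m α β) w := by
  have hα' : (α : ℂ) ≠ 0 := by exact_mod_cast hα.ne'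
  have hβ' : (β : ℂ) ≠ 0 := by exact_mod_cast hβ.ne'
  have hg := differentiableAt_psiMellin k (w := w) (by linarith)
  have hz2 : DifferentiableAt ℂ riemannZeta w :=
    differentiableAt_riemannZeta (by rintro rfl; simp at hw)
  have hz1 : DifferentiableAt ℂ (fun w : ℂ => riemannZeta₁ (w + 1 - 2 * m)) w := by fun_prop
  have h2p : DifferentiableAt ℂ (fun s : ℂ => (2 : ℂ) ^ (-(k : ℂ) * s)) w :=
    DifferentiableAt.const_cpow (by fun_prop) (Or.inl two_ne_zero)
  have hap : DifferentiableAt ℂ (fun s : ℂ => (α : ℂ) ^ (-(k : ℂ) * (s - m))) w :=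
    DifferentiableAt.const_cpow (by fun_prop) (Or.inl hα')
  have hbp : DifferentiableAt ℂ (fun s : ℂ => (β : ℂ) ^ (-(k : ℂ) * (s - m))) w :=
    DifferentiableAt.const_cpow (by fun_prop) (Or.inl hβ')
  unfold eisensteinNumerator
  fun_prop

lemma expBoundedOnStrip_eisensteinMellin {k : ℕ} (hk : 1 ≤ k) (m : ℕ) {α : ℝ} (hα : 0 < α)
    {a : ℝ} (ha : 0 < a) (b : ℝ) :
    ExpBoundedOnStrip (eisensteinMellin k m α) a b (-(Real.pi / 8)) := by
  have hk' : (0 : ℝ) < k := by exact_mod_cast hk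
  -- There are `2k` zeta factors, so this growth rate for each costs `π/8` out of the available
  -- decay `π/4`.
  have hε : 0 < Real.pi / (16 * k) := by have := Real.pi_pos; positivity
  have hz2 : ExpBoundedOnStrip (fun w => riemannZeta (w + 1 - 2 * m)) a b (Real.pi / (16 * k)) := by
    refine (ExpBoundedOnStrip.comp_add_real (c := 1 - 2 * m)
      (ExpBoundedOnStrip.zeta _ _ hε)).congr fun s _ _ _ => ?_
    congr 1
    push_cast
    ring
  have h2p := ExpBoundedOnStrip.const_cpow (two_pos) (f := fun w : ℂ => -(k : ℂ) * w)
    (φ := fun σ => -k * σ) (by fun_prop) (fun s => by simp) a b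
  have hap := ExpBoundedOnStrip.const_cpow hα (f := fun w : ℂ => -(k : ℂ) * (w - m))
    (φ := fun σ => -k * (σ - m)) (by fun_prop) (fun s => by simp) a b
  refine ((((((expBoundedOnStrip_psiMellin hk ha b).mul
    ((ExpBoundedOnStrip.zeta a b hε).pow k)).mul (hz2.pow k)).mul h2p).mul hap).mono_exp
      (le_of_eq ?_)).congr fun s _ _ _ => ?_
  · field_simp
    ring
  · simp [eisensteinMellin]

lemma expBoundedOnStrip_eisensteinOdd {k : ℕ} (hk : 1 ≤ k) (m : ℕ) {α β : ℝ} (hα : 0 < α)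
    (hβ : 0 < β) {a : ℝ} (ha : 0 < a) (b : ℝ) :
    ExpBoundedOnStrip (eisensteinOdd k m α β) a b (-(Real.pi / 8)) :=
  (expBoundedOnStrip_eisensteinMellin hk m hα ha b).sub
    ((expBoundedOnStrip_eisensteinMellin hk m hβ ha b).const_mul _)

lemma ne_of_im_ne_zero {w : ℂ} (hw : w.im ≠ 0) (x : ℝ) : w ≠ x := by
  rintro rfl
  simp at hw

/-! ### Vanishing on the central line and evaluation of the residue. -/

lemma integral_eisensteinOdd_eq_zero {k m : ℕ} (hk : 1 ≤ k) {α β : ℝ} (hα : 0 < α) (hβ : 0 < β)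
    (hαβ : α * β = Real.pi ^ 2) : ∫ t : ℝ, eisensteinOdd k m α β ((m : ℝ) + t * I) = 0 := by
  have h : ∫ t : ℝ, eisensteinOdd k m α β ((m : ℝ) + t * I) =
      ∫ t : ℝ, -eisensteinOdd k m α β ((m : ℝ) + t * I) := by
    rw [← integral_neg_eq_self]
    refine integral_congr_ae ?_
    -- On `Re w = m` the reflection is `t ↦ -t`. The real point `t = 0`, where the functional
    -- equation may not apply, is a null set; every excluded point is real.
    filter_upwards [Measure.ae_ne volume (0 : ℝ)] with t ht
    have him : (((m : ℝ) : ℂ) + t * I).im ≠ 0 := by simpa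
    have him' : (2 * m - (((m : ℝ) : ℂ) + t * I)).im ≠ 0 := by simpa
    rw [← eisensteinOdd_reflect hk hα hβ hαβ
      (fun n => by simpa using ne_of_im_ne_zero him (-n))
      (by simpa using ne_of_im_ne_zero him 1)
      (fun n => by simpa using ne_of_im_ne_zero him' (-n))
      (by simpa using ne_of_im_ne_zero him' 1)]
    · congr 1
      push_cast
      ring
    · intro hcos
      obtain ⟨j, hj⟩ := cos_eq_zero_iff.1 hcos
      have hpi : (Real.pi : ℂ) ≠ 0 := by exact_mod_cast Real.pi_ne_zero
      have : ((m : ℝ) : ℂ) + t * I = ((2 * j + 1 : ℝ) : ℂ) := by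
        push_cast at hj ⊢
        field_simp at hj
        linear_combination hj
      exact ne_of_im_ne_zero him _ this
  rw [integral_neg] at h
  exact self_eq_neg.1 h

lemma continuous_line_eisensteinOdd (k : ℕ) {m : ℕ} {α β : ℝ} (hα : 0 < α) (hβ : 0 < β)
    {c : ℝ} (hc : 1 < c) (hcm : c ≠ 2 * m) :
    Continuous fun t : ℝ => eisensteinOdd k m α β (c + t * I) := by
  have hne : ∀ t : ℝ, (c : ℂ) + t * I - 2 * m ≠ 0 := fun t => by
    simpa using line_sub_ne_zero hcm t
  have h : ∀ t : ℝ, eisensteinOdd k m α β (c + t * I) =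
      eisensteinNumerator k m α β (c + t * I) / ((c : ℂ) + t * I - 2 * m) ^ k := fun t =>
    eisensteinOdd_eq_div k m α β (sub_ne_zero.1 (hne t))
  simp_rw [h]
  refine Continuous.div (continuous_iff_continuousAt.2 fun t => ?_) (by fun_prop)
    fun t => pow_ne_zero _ (hne t)
  exact ContinuousAt.comp (g := eisensteinNumerator k m α β) (f := fun t : ℝ => (c : ℂ) + t * I)
    (differentiableAt_eisensteinNumerator k m hα hβ (by simpa)).continuousAt (by fun_prop)

/-- Between `Re w = m` and `Re w = c` the only possible pole is `2m`, since `m > 1` keeps the pole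
of `ζ(w)` at `1` outside the strip. The central line contributes zero, so the integral is the
residue alone. -/
lemma integral_eisensteinOdd {k m : ℕ} (hk : 1 ≤ k) (hm : 1 < m) {α β : ℝ} (hα : 0 < α)
    (hβ : 0 < β) (hαβ : α * β = Real.pi ^ 2) {c : ℝ} (hc : 2 * m < c) :
    1 / (2 * Real.pi) * ∫ t : ℝ, eisensteinOdd k m α β (c + t * I) =
      iteratedDeriv (k - 1) (eisensteinNumerator k m α β) (2 * m) / (k - 1).factorial := by
  obtain ⟨n, rfl⟩ : ∃ n, k = n + 1 := ⟨k - 1, by omega⟩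
  have hm' : (1 : ℝ) < m := by exact_mod_cast hm
  have hap : (m : ℝ) < 2 * m := by linarith
  have hmc : (m : ℝ) ≤ c := (hap.trans hc).le
  have hd : -(Real.pi / 8) < 0 := by linarith [Real.pi_pos]
  have hE := expBoundedOnStrip_eisensteinOdd hk m hα hβ (by linarith : (0 : ℝ) < m) c
  have hcongr : ∀ s : ℂ, s ≠ 2 * m → eisensteinNumerator (n + 1) m α β s /
      (s - ((2 * m : ℝ) : ℂ)) ^ (n + 1) = eisensteinOdd (n + 1) m α β s := fun s hs => by
    rw [eisensteinOdd_eq_div _ _ _ _ hs]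
    push_cast
    rfl
  have hne : ∀ x : ℝ, x ≠ 2 * m → ∀ t : ℝ, (x : ℂ) + t * I ≠ 2 * m := fun x hx t h =>
    line_sub_ne_zero hx t (by rw [h]; push_cast; ring)
  have hv : VanishesOnHorizontals (fun s => eisensteinNumerator (n + 1) m α β s /
      (s - ((2 * m : ℝ) : ℂ)) ^ (n + 1)) m c := by
    refine (hE.vanishesOnHorizontals hd).congr fun s _ _ h3 => hcongr s ?_
    have him : s.im ≠ 0 := fun h => by rw [h] at h3; norm_num at h3
    simpa using ne_of_im_ne_zero him (2 * m)
  have h1 := tendsto_stripDiff_pole hap hc n _ (fun w hw =>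
    (differentiableAt_eisensteinNumerator (n + 1) m hα hβ
      (hm'.trans_le hw.1)).differentiableWithinAt) hv
  have h2 := tendsto_stripDiff_of_integrable
    (hE.integrable_line hd le_rfl hmc (continuous_line_eisensteinOdd (n + 1) hα hβ hm' hap.ne))
    (hE.integrable_line hd hmc le_rfl
      (continuous_line_eisensteinOdd (n + 1) hα hβ (hm'.trans_le hmc) hc.ne'))
  rw [integral_eisensteinOdd_eq_zero hk hα hβ hαβ, sub_zero] at h2
  have h3 : stripDiff (fun s => eisensteinNumerator (n + 1) m α β s /
      (s - ((2 * m : ℝ) : ℂ)) ^ (n + 1)) m c = stripDiff (eisensteinOdd (n + 1) m α β) m c := by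
    ext T
    simp only [stripDiff]
    congr 1 <;> refine intervalIntegral.integral_congr fun t _ => ?_
    · exact hcongr _ (hne c hc.ne' t)
    · exact hcongr _ (hne m hap.ne t)
  rw [h3] at h1
  have hpi : (Real.pi : ℂ) ≠ 0 := by exact_mod_cast Real.pi_ne_zero
  rw [tendsto_nhds_unique h2 h1, Nat.add_sub_cancel]
  push_cast
  field_simp

/-- Oddness makes the numerator at `w` equal to `-(-1)^k` times the kernel at `2m - w`. The chain
rule adds `(-1)^(k-1)`, and the two signs cancel. -/
lemma iteratedDeriv_eisensteinNumerator {k m : ℕ} (hk : 1 ≤ k) (hm : 1 < m) {α β : ℝ}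
    (hα : 0 < α) (hβ : 0 < β) (hαβ : α * β = Real.pi ^ 2) :
    iteratedDeriv (k - 1) (eisensteinNumerator k m α β) (2 * m) =
      iteratedDeriv (k - 1) (eisensteinKernel k m α β) 0 := by
  have hm' : (1 : ℝ) < m := by exact_mod_cast hm
  have hre : (1 : ℝ) < (2 * m : ℂ).re := by simp; linarith
  have hcontK : ContinuousAt (eisensteinNumerator k m α β) (2 * m) :=
    (differentiableAt_eisensteinNumerator k m hα hβ hre).continuousAt
  have hker : ContinuousAt (fun w : ℂ => -(-1) ^ k * eisensteinKernel k m α β (2 * m - w))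
      (2 * m) := by
    refine continuousAt_const.mul (ContinuousAt.comp (g := eisensteinKernel k m α β) ?_
      (by fun_prop))
    rw [sub_self]
    exact (analyticAt_eisensteinKernel k hm.le hα hβ).continuousAt
  have hev : eisensteinNumerator k m α β =ᶠ[𝓝 (2 * m : ℂ)]
      fun w => -(-1) ^ k * eisensteinKernel k m α β (2 * m - w) := by
    -- The reflection is available only off `w = 2m`; continuity of both sides fills in the point.
    rw [← hcontK.eventuallyEq_nhds_iff_eventuallyEq_nhdsNE hker]
    have h1 : ∀ᶠ w : ℂ in 𝓝 (2 * m : ℂ), 1 < w.re :=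
      (isOpen_lt continuous_const continuous_re).mem_nhds hre
    -- Within distance one, `2m - w` can be neither `1` nor a negative integer.
    have h2 : ∀ᶠ w : ℂ in 𝓝 (2 * m : ℂ), ‖2 * m - w‖ < 1 := by
      have : ContinuousAt (fun w : ℂ => ‖2 * m - w‖) (2 * m) := by fun_prop
      exact this.eventually_lt continuousAt_const (by simp)
    have h3 : ∀ᶠ w : ℂ in 𝓝 (2 * m : ℂ), cos (Real.pi * w / 2) ≠ 0 := by
      refine ContinuousAt.eventually_ne (by fun_prop) ?_
      have h := cos_pi_mul_nat_sub m 0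
      rw [sub_zero] at h
      rw [h]
      simp
    filter_upwards [h1.filter_mono nhdsWithin_le_nhds, h2.filter_mono nhdsWithin_le_nhds,
      h3.filter_mono nhdsWithin_le_nhds, self_mem_nhdsWithin] with w hw1 hw2 hw3 hw4
    have hne : w ≠ 2 * m := hw4
    have hs : 2 * m - w ≠ 0 := sub_ne_zero.2 hne.symm
    rw [eisensteinKernel_eq k m α β hs, eisensteinOdd_reflect hk hα hβ hαβ _ _ _ _ hw3,
      eisensteinOdd_eq_div k m α β hne, ← neg_sub w, neg_pow (w - 2 * m)]
    · have h4 : (w - 2 * m) ^ k ≠ 0 := pow_ne_zero _ (sub_ne_zero.2 hne)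
      have hsq : ((-1 : ℂ) ^ k) * (-1) ^ k = 1 := by rw [← mul_pow]; norm_num
      field_simp
      linear_combination (-eisensteinNumerator k m α β w) * hsq
    · rintro n rfl
      have h0 : (0 : ℝ) ≤ n := n.cast_nonneg
      simp at hw1
      linarith
    · rintro rfl
      simp at hw1
    · intro n hn
      rw [hn] at hw2 hs
      rw [norm_neg, Complex.norm_natCast] at hw2
      have : n = 0 := by
        have : n < 1 := by exact_mod_cast hw2
        omega
      simp [this] at hs
    · intro h
      simp [h] at hw2
  rw [hev.iteratedDeriv_eq, iteratedDeriv_const_mul_field,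
    congrFun (iteratedDeriv_comp_const_sub (k - 1) (eisensteinKernel k m α β) (2 * m)) (2 * m),
    sub_self, smul_eq_mul]
  obtain ⟨n, rfl⟩ : ∃ n, k = n + 1 := ⟨k - 1, by omega⟩
  have hsq : ((-1 : ℂ) ^ n) * (-1) ^ n = 1 := by rw [← mul_pow]; norm_num
  rw [Nat.add_sub_cancel, pow_succ]
  linear_combination (iteratedDeriv n (eisensteinKernel (n + 1) m α β) 0) * hsq

/-! ### The two series as line integrals, and the formula. -/

lemma continuous_line_eisensteinMellin (k : ℕ) {m : ℕ} (hm : 1 < m) {α : ℝ} (hα : 0 < α) {c : ℝ}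
    (hc : 2 * m < c) : Continuous fun t : ℝ => eisensteinMellin k m α (c + t * I) := by
  have hm' : (1 : ℝ) < m := by exact_mod_cast hm
  refine continuous_iff_continuousAt.2 fun t => ContinuousAt.comp (g := eisensteinMellin k m α)
    (f := fun t : ℝ => (c : ℂ) + t * I) (DifferentiableAt.continuousAt (𝕜 := ℂ) ?_) (by fun_prop)
  have hre : ((c : ℂ) + t * I).re = c := by simp
  generalize (c : ℂ) + t * I = w at hre
  have hg := differentiableAt_psiMellin k (w := w) (by linarith)
  have hz2 : DifferentiableAt ℂ riemannZeta w :=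
    differentiableAt_riemannZeta (by rintro rfl; simp at hre; linarith)
  have hz1 : DifferentiableAt ℂ (fun w : ℂ => riemannZeta (w + 1 - 2 * m)) w := by
    refine DifferentiableAt.comp (g := riemannZeta) w (differentiableAt_riemannZeta fun h => ?_)
      (by fun_prop)
    have := congrArg re h
    simp at this
    linarith
  have h2p : DifferentiableAt ℂ (fun s : ℂ => (2 : ℂ) ^ (-(k : ℂ) * s)) w :=
    DifferentiableAt.const_cpow (by fun_prop) (Or.inl two_ne_zero)
  have hap : DifferentiableAt ℂ (fun s : ℂ => (α : ℂ) ^ (-(k : ℂ) * (s - m))) w :=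
    DifferentiableAt.const_cpow (by fun_prop) (Or.inl (by exact_mod_cast hα.ne'))
  unfold eisensteinMellin
  fun_prop

lemma eisenstein_eq_integral {k m : ℕ} (hk : 1 ≤ k) (hm : 1 < m) {C α c : ℝ} (hC : C < 0)
    (hα : 0 < α) (hc : 2 * m < c) :
    Summable (fun n : ℕ+ =>
      (piltzDivisor k n : ℂ) * (n : ℂ) ^ (2 * m - 1) * Psi k C ((2 * α) ^ k) n) ∧
    ((α : ℂ) ^ k) ^ m * (∑' n : ℕ+,
        (piltzDivisor k n : ℂ) * (n : ℂ) ^ (2 * m - 1) * Psi k C ((2 * α) ^ k) n) =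
      1 / (2 * Real.pi) * ∫ t : ℝ, eisensteinMellin k m α (c + t * I) := by
  have hcast : ((2 * m - 1 : ℕ) : ℝ) = 2 * m - 1 := by
    rw [Nat.cast_sub (by omega)]; push_cast; rfl
  have hcast' : ((2 * m - 1 : ℕ) : ℂ) = 2 * m - 1 := by
    rw [Nat.cast_sub (by omega)]; push_cast; rfl
  have h := hasSum_eisenstein hk hC (by positivity : 0 < (2 * α) ^ k) (2 * m - 1) (c := c)
    (by rw [hcast]; linarith)
  refine ⟨h.summable, ?_⟩
  rw [h.tsum_eq, mul_left_comm, ← integral_const_mul]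
  congr 2 with t
  generalize (c : ℂ) + t * I = w
  have hα' : (α : ℂ) ≠ 0 := by exact_mod_cast hα.ne'
  have h1 : (((2 * α) ^ k : ℝ) : ℂ) ^ (-w) = (2 : ℂ) ^ (-(k : ℂ) * w) * (α : ℂ) ^ (-(k : ℂ) * w) := by
    rw [ofReal_pow, ofReal_pow_cpow (by positivity), ofReal_mul,
      mul_cpow_ofReal_nonneg zero_le_two hα.le, mul_neg, ← neg_mul, ofReal_ofNat]
  -- The prefactor `α^(km)` is exactly what centres the power of `α` at `w = m`.
  have h2 : (α : ℂ) ^ (-(k : ℂ) * (w - m)) = ((α : ℂ) ^ k) ^ m * (α : ℂ) ^ (-(k : ℂ) * w) := by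
    rw [← pow_mul, ← cpow_natCast, ← cpow_add _ _ hα']
    congr 1
    push_cast
    ring
  rw [h1, eisensteinMellin, h2, hcast', show w - (2 * m - 1) = w + 1 - 2 * m by ring]
  ring

theorem corollary1p4 (k m : ℕ) (hk : 1 ≤ k) (hm : 1 < m) (α β : ℝ) (hα : 0 < α) (hβ : 0 < β)
    (hαβ : α * β = Real.pi ^ 2) (C : ℝ) (hC : C < 0) :
    -- the integrals defining the `G`-functions converge absolutely
    (∀ z : ℝ, 0 < z → MeasureTheory.Integrable (fun t : ℝ =>
      meijerGIntegrand (k + 1) 0 (Fin.elim0 : Fin 0 → ℂ) (psiParam k) z (C + t * Complex.I))) ∧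
    -- the series defining `Ψ` converges absolutely
    (∀ ρ x : ℝ, 0 < ρ → 0 < x → Summable (fun j : ℕ+ => psiTerm k C ρ x j)) ∧
    -- the two series over `n` converge absolutely
    Summable (fun n : ℕ+ =>
      (piltzDivisor k n : ℂ) * (n : ℂ) ^ (2 * m - 1) * Psi k C ((2 * α) ^ k) n) ∧
    Summable (fun n : ℕ+ =>
      (piltzDivisor k n : ℂ) * (n : ℂ) ^ (2 * m - 1) * Psi k C ((2 * β) ^ k) n) ∧
    -- the function that is differentiated is holomorphic near `0`
    AnalyticAt ℂ (eisensteinKernel k m α β) 0 ∧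
    -- the transformation formula
    ((α : ℂ) ^ k) ^ m * (∑' n : ℕ+,
        (piltzDivisor k n : ℂ) * (n : ℂ) ^ (2 * m - 1) * Psi k C ((2 * α) ^ k) n) -
      (-(β : ℂ) ^ k) ^ m * (∑' n : ℕ+,
        (piltzDivisor k n : ℂ) * (n : ℂ) ^ (2 * m - 1) * Psi k C ((2 * β) ^ k) n) =
      1 / ((k - 1).factorial : ℂ) * iteratedDeriv (k - 1) (eisensteinKernel k m α β) 0 := by
  -- Any abscissa to the right of `2m` would serve; `2m + 1` is used for both series.
  have hc : (2 * m : ℝ) < 2 * m + 1 := by linarith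
  have hm' : (1 : ℝ) < m := by exact_mod_cast hm
  have hpi := Real.pi_pos
  obtain ⟨ha1, ha2⟩ := eisenstein_eq_integral hk hm hC hα hc
  obtain ⟨hb1, hb2⟩ := eisenstein_eq_integral hk hm hC hβ hc
  refine ⟨fun z hz => integrable_meijerGIntegrand hk hC hz,
    fun ρ x hρ hx => summable_psiTerm hk hC hρ hx, ha1, hb1,
    analyticAt_eisensteinKernel k hm.le hα hβ, ?_⟩
  have hint : ∀ γ : ℝ, 0 < γ → Integrable fun t : ℝ =>
      eisensteinMellin k m γ (((2 * m + 1 : ℝ) : ℂ) + t * I) := by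
    intro γ hγ
    exact (expBoundedOnStrip_eisensteinMellin hk m hγ (by linarith : (0 : ℝ) < 2 * m + 1)
      (2 * m + 1)).integrable_line (by linarith) le_rfl le_rfl
      (continuous_line_eisensteinMellin k hm hγ hc)
  have hodd := integral_eisensteinOdd hk hm hα hβ hαβ hc
  simp only [eisensteinOdd] at hodd
  rw [integral_sub (hint α hα) ((hint β hβ).const_mul _), integral_const_mul,
    iteratedDeriv_eisensteinNumerator hk hm hα hβ hαβ] at hodd
  -- Pulling `(-1)^m` out of `(-β^k)^m` produces the coefficient that makes the combination odd.
  rw [neg_pow, mul_assoc, ha2, hb2]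
  linear_combination hodd
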